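/- All structures are finite and nonempty. A vocabulary is a finite set of relation names, each with a type in $\{\text{element},\text{set}\}^*$; a structure interprets each relation name as a relation on elements and subsets of its universe of that type; a class of structures consists of structures over one vocabulary and is closed under isomorphism. MSO means monadic second-order logic with the set predicates "$|X|$ is divisible by $p$" for $p\ge 2$. An MSO transduction is a finite composition, up to isomorphism of the output, of: interpretations (MSO formulas define a nonempty subset of the universe as the new universe, and the new relations on it); filterings by an MSO sentence; $k$-copyings (replace a structure by $k\ge 2$ disjoint copies of it, with a new $k$-ary relation containing the tuples $(a_1,\ldots,a_k)$ of the successive copies of each element); and $k$-colourings (add, nondeterministically, $k\ge 1$ unary relations that partition the universe). A tree is a rooted, unranked, unordered, unlabelled tree, seen as a structure whose universe is the set of nodes, with the binary parent relation. A class of structures has bounded MSO width if it is contained in the image, under some MSO transduction, of the class of trees. A hypergraph is a finite nonempty set $V$ of vertices with a family of subsets of $V$ called hyperedges, seen as a structure with universe $V$ and one unary relation on sets. For $U\subseteq V$ let $\rho(U)$ be the rank over the two-element field of the $0/1$ matrix with rows indexed by the subsets $X\subseteq U$, columns indexed by the subsets $Z\subseteq V\setminus U$, and entry $1$ exactly when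 $X\cup Z$ is a hyperedge. A tree decomposition is a rooted binary tree (every node has zero or two children) with a bijection between its leaves and $V$. Its width is the maximum over its nodes $x$ of $\rho(U_x)$, where $U_x$ is the set of vertices in the leaves of the subtree of $x$. The hyper-rankwidth of a hypergraph is the minimum width of its tree decompositions, and a class of hypergraphs has bounded hyper-rankwidth if some $k\in\mathbb{N}$ bounds the hyper-rankwidth of all its members. Theorem. A class of hypergraphs has bounded MSO width if and only if it has bounded hyper-rankwidth. -/

import Mathlib

namespace MSO

/-! ### Vocabularies and structures -/

/-- The two kinds of arguments of a relation: elements of the universe, and sets of elements. -/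
inductive Kind where
  | elem
  | set

/-- A vocabulary: finitely many relation names, each one with a type in `{elem, set}*`. -/
structure Vocab where
  Rel : Type
  finite_rel : Finite Rel
  type : Rel → List Kind

/-- The objects of a given kind over a universe `A`. -/
abbrev Val (A : Type) : Kind → Type
  | .elem => A
  | .set => Set A

/-- The image of an object under a function between universes
(the value of the function on elements, the direct image on sets). -/
def Val.map {A B : Type} (f : A → B) : {κ : Kind} → Val A κ → Val B κ
  | .elem, a => f a
  | .set, X => Set.image f X

/-- `Val.Within P a`: the element `a` satisfies `P`; for a set, all its elements satisfy `P`. -/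
def Val.Within {A : Type} (P : A → Prop) : {κ : Kind} → Val A κ → Prop
  | .elem, a => P a
  | .set, X => ∀ a : A, a ∈ (X : Set A) → P a

/-- `Var Γ κ` is the type of positions in the word `Γ` that carry the letter `κ`. -/
inductive Var : List Kind → Kind → Type where
  | zero {κ : Kind} {Γ : List Kind} : Var (κ :: Γ) κ
  | succ {κ κ' : Kind} {Γ : List Kind} (v : Var Γ κ) : Var (κ' :: Γ) κ

/-- The index (counted from `0`) of a position. -/
def Var.idx {κ : Kind} : {Γ : List Kind} → Var Γ κ → ℕ
  | _, .zero => 0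
  | _, .succ v => v.idx + 1

/-- Tuples of type `Γ` over a universe `A`: an object of the right kind at every position. -/
def Tuple (A : Type) (Γ : List Kind) : Type :=
  ∀ κ : Kind, Var Γ κ → Val A κ

def Tuple.nil {A : Type} : Tuple A [] := fun _ v => nomatch v

def Tuple.cons {A : Type} {κ : Kind} {Γ : List Kind} (a : Val A κ) (t : Tuple A Γ) :
    Tuple A (κ :: Γ)
  | _, .zero => a
  | _, .succ v => t _ v

def Tuple.map {A B : Type} (f : A → B) {Γ : List Kind} (t : Tuple A Γ) : Tuple B Γ :=
  fun κ v => (t κ v).map f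

/-- A structure over a vocabulary; the universe is finite and nonempty. -/
structure Str (σ : Vocab) where
  carrier : Type
  finite_carrier : Finite carrier
  nonempty_carrier : Nonempty carrier
  rel : ∀ r : σ.Rel, Tuple carrier (σ.type r) → Prop

/-- Isomorphism of structures. -/
def Str.Iso {σ : Vocab} (A B : Str σ) : Prop :=
  ∃ e : A.carrier ≃ B.carrier, ∀ (r : σ.Rel) (t : Tuple A.carrier (σ.type r)),
    A.rel r t ↔ B.rel r (t.map e)

/-- A class of structures over a common vocabulary, invariant under isomorphism. -/
structure StrClass (σ : Vocab) where
  Mem : Str σ → Prop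
  iso_invariant : ∀ A B : Str σ, A.Iso B → Mem A → Mem B

/-! ### Monadic second-order logic with modulo counting -/

/-- Formulas whose free variables are the positions of `Γ`, of the corresponding kinds.
A quantifier binds a new variable at the front of the context. -/
inductive Formula (σ : Vocab) : List Kind → Type where
  | eq {Γ : List Kind} (x y : Var Γ .elem) : Formula σ Γ
  | mem {Γ : List Kind} (x : Var Γ .elem) (X : Var Γ .set) : Formula σ Γ
  | rel {Γ : List Kind} (r : σ.Rel) (args : ∀ κ : Kind, Var (σ.type r) κ → Var Γ κ) : Formula σ Γ
  | card {Γ : List Kind} (p : ℕ) (hp : 2 ≤ p) (X : Var Γ .set) : Formula σ Γ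
  | not {Γ : List Kind} (φ : Formula σ Γ) : Formula σ Γ
  | and {Γ : List Kind} (φ ψ : Formula σ Γ) : Formula σ Γ
  | ex {Γ : List Kind} (κ : Kind) (φ : Formula σ (κ :: Γ)) : Formula σ Γ

/-- Satisfaction; `card p _ X` says that the number of elements of `X` is divisible by `p`. -/
def Formula.Sat {σ : Vocab} (A : Str σ) :
    {Γ : List Kind} → Formula σ Γ → Tuple A.carrier Γ → Prop
  | _, .eq x y, t => t .elem x = t .elem y
  | _, .mem x X, t => (t .elem x : A.carrier) ∈ (t .set X : Set A.carrier)
  | _, .rel r args, t => A.rel r (fun κ v => t κ (args κ v))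
  | _, .card p _ X, t => p ∣ Set.ncard (α := A.carrier) (t .set X)
  | _, .not φ, t => ¬ φ.Sat A t
  | _, .and φ ψ, t => φ.Sat A t ∧ ψ.Sat A t
  | _, .ex κ φ, t => ∃ a : Val A.carrier κ, φ.Sat A (Tuple.cons a t)

/-! ### Transductions -/

/-- The syntax of an interpretation: a universe formula and relation formulas. The relation
formulas use only elements that satisfy the universe formula. -/
structure Interpretation (σ τ : Vocab) where
  univ : Formula σ [.elem]
  rel : ∀ r : τ.Rel, Formula σ (τ.type r)
  consistent : ∀ (A : Str σ) (r : τ.Rel) (t : Tuple A.carrier (τ.type r)), (rel r).Sat A t →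
    ∀ (κ : Kind) (v : Var (τ.type r) κ),
      (t κ v).Within (fun a => univ.Sat A (Tuple.cons (κ := .elem) a Tuple.nil))

/-- The elements selected by the universe formula. -/
def Interpretation.Universe {σ τ : Vocab} (I : Interpretation σ τ) (A : Str σ) : Type :=
  {a : A.carrier // I.univ.Sat A (Tuple.cons (κ := .elem) a Tuple.nil)}

/-- The output structure of an interpretation, when its universe is nonempty. -/
def Interpretation.output {σ τ : Vocab} (I : Interpretation σ τ) (A : Str σ)
    (h : Nonempty (I.Universe A)) : Str τ where
  carrier := I.Universe A
  finite_carrier := haveI := A.finite_carrier; Subtype.finite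
  nonempty_carrier := h
  rel r t := (I.rel r).Sat A (t.map Subtype.val)

/-- The vocabulary with a new relation name, of type `elem ⋯ elem` (`k` times). -/
def Vocab.addCopy (σ : Vocab) (k : ℕ) : Vocab where
  Rel := σ.Rel ⊕ Unit
  finite_rel := haveI := σ.finite_rel; inferInstance
  type
    | .inl r => σ.type r
    | .inr _ => List.replicate k .elem

/-- The disjoint union of `k` copies of a structure. An old relation holds for a tuple if all its
elements and sets live in one copy and the relation holds for the corresponding tuple of the input
structure. The new relation consists of the tuples `(a₁, …, aₖ)` of all the copies of some element,
in order. -/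
def Str.copy {σ : Vocab} (A : Str σ) (k : ℕ) (hk : 2 ≤ k) : Str (σ.addCopy k) where
  carrier := A.carrier × Fin k
  finite_carrier := haveI := A.finite_carrier; inferInstance
  nonempty_carrier := haveI := A.nonempty_carrier; haveI : NeZero k := ⟨by omega⟩; inferInstance
  rel
    | .inl r => fun t => ∃ (i : Fin k) (s : Tuple A.carrier (σ.type r)),
        A.rel r s ∧ t = s.map (fun a => (a, i))
    | .inr _ => fun (t : Tuple (A.carrier × Fin k) (List.replicate k .elem)) =>
        ∃ a : A.carrier, ∀ (v : Var (List.replicate k .elem) .elem) (i : Fin k),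
          (i : ℕ) = v.idx → t .elem v = (a, i)

/-- The vocabulary with `k` new unary relation names. -/
def Vocab.addColours (σ : Vocab) (k : ℕ) : Vocab where
  Rel := σ.Rel ⊕ Fin k
  finite_rel := haveI := σ.finite_rel; inferInstance
  type
    | .inl r => σ.type r
    | .inr _ => [.elem]

/-- The structure with `k` new unary relations that partition the universe, given by the function
which maps an element to the unique new relation that it satisfies. -/
def Str.colour {σ : Vocab} (A : Str σ) (k : ℕ) (c : A.carrier → Fin k) : Str (σ.addColours k) where
  carrier := A.carrier
  finite_carrier := A.finite_carrier
  nonempty_carrier := A.nonempty_carrier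
  rel
    | .inl r => fun t => A.rel r t
    | .inr i => fun t => c (t .elem .zero) = i

/-- The syntax of elementary transductions. -/
inductive Elementary : Vocab → Vocab → Type 1 where
  | interpretation {σ τ : Vocab} (I : Interpretation σ τ) : Elementary σ τ
  | filtering {σ : Vocab} (φ : Formula σ []) : Elementary σ σ
  | copying {σ : Vocab} (k : ℕ) (hk : 2 ≤ k) : Elementary σ (σ.addCopy k)
  | colouring {σ : Vocab} (k : ℕ) (hk : 1 ≤ k) : Elementary σ (σ.addColours k)

/-- The input-output relation of an elementary transduction. -/
def Elementary.Out : {σ τ : Vocab} → Elementary σ τ → Str σ → Str τ → Prop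
  | _, _, .interpretation I, A, B => ∃ h : Nonempty (I.Universe A), B = I.output A h
  | _, _, .filtering φ, A, B => φ.Sat A Tuple.nil ∧ B = A
  | _, _, .copying k hk, A, B => B = A.copy k hk
  | _, _, .colouring k _, A, B => ∃ c : A.carrier → Fin k, B = A.colour k c

/-- The syntax of transductions: finite sequences of elementary transductions. -/
inductive Transduction : Vocab → Vocab → Type 1 where
  | nil {σ : Vocab} : Transduction σ σ
  | cons {σ τ υ : Vocab} (e : Elementary σ τ) (f : Transduction τ υ) : Transduction σ υ

/-- The input-output relation of a transduction: the composition of the elementary steps,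
followed by an implicit last step, which replaces the output by any isomorphic structure. -/
def Transduction.Out : {σ τ : Vocab} → Transduction σ τ → Str σ → Str τ → Prop
  | _, _, .nil, A, B => A.Iso B
  | _, _, .cons e f, A, C => ∃ B, e.Out A B ∧ f.Out B C

/-! ### Trees and width -/

/-- The vocabulary of trees: a binary relation `parent(x, y)`, "`x` is the parent of `y`". -/
def treeVocab : Vocab where
  Rel := Unit
  finite_rel := inferInstance
  type _ := [.elem, .elem]

def Str.Parent (T : Str treeVocab) (x y : T.carrier) : Prop :=
  T.rel () (Tuple.cons (κ := .elem) x (Tuple.cons (κ := .elem) y Tuple.nil))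

/-- Rooted trees, which are unranked, unordered and unlabelled: the root has no parent, every other
node has exactly one parent, and every node is reachable from the root. -/
def Str.IsTree (T : Str treeVocab) : Prop :=
  ∃ root : T.carrier, (∀ x, ¬ T.Parent x root) ∧ (∀ y, y ≠ root → ∃! x, T.Parent x y) ∧
    ∀ y, Relation.ReflTransGen T.Parent root y

/-- A class of structures has bounded width if it is contained in the image of the class of trees
under some transduction. -/
def StrClass.BoundedMSOWidth {σ : Vocab} (C : StrClass σ) : Prop :=
  ∃ f : Transduction treeVocab σ, ∀ A : Str σ, C.Mem A → ∃ T : Str treeVocab, T.IsTree ∧ f.Out T A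

/-! ### Hypergraphs and hyper-rankwidth -/

/-- The vocabulary of hypergraphs: one unary relation on sets, "`X` is a hyperedge". -/
def hypergraphVocab : Vocab where
  Rel := Unit
  finite_rel := inferInstance
  type _ := [.set]

/-- Hypergraphs; the universe of the structure is the set of vertices. -/
abbrev Hypergraph : Type 1 := Str hypergraphVocab

def Str.Hyperedge (H : Hypergraph) (X : Set H.carrier) : Prop :=
  H.rel () (Tuple.cons (κ := .set) X Tuple.nil)

open Classical in
/-- The matrix of the partition of the vertices into `U` and its complement: rows are subsets of
`U`, columns are subsets of the complement, and an entry says whether the union of the row and the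
column is a hyperedge. -/
noncomputable def Str.cutMatrix (H : Hypergraph) (U : Set H.carrier) :
    Matrix {X : Set H.carrier // X ⊆ U} {Z : Set H.carrier // Z ⊆ Uᶜ} (ZMod 2) :=
  Matrix.of fun X Z => if H.Hyperedge (X.1 ∪ Z.1) then 1 else 0

/-- The rank, over the two-element field, of the matrix of the partition. -/
noncomputable def Str.cutRank (H : Hypergraph) (U : Set H.carrier) : ℕ :=
  haveI := H.finite_carrier
  letI := Fintype.ofFinite {Z : Set H.carrier // Z ⊆ Uᶜ}
  (H.cutMatrix U).rank

/-- Binary trees with leaves labelled by elements of `V`. -/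
inductive BinTree (V : Type) where
  | leaf (v : V)
  | node (l r : BinTree V)

/-- The labels of the leaves, from left to right. -/
def BinTree.leaves {V : Type} : BinTree V → List V
  | .leaf v => [v]
  | .node l r => l.leaves ++ r.leaves

/-- A tree decomposition with vertices `V`: every vertex is the label of exactly one leaf. -/
def BinTree.IsDecomposition {V : Type} (T : BinTree V) : Prop :=
  T.leaves.Nodup ∧ ∀ v : V, v ∈ T.leaves

/-- The maximum, over the nodes `x` of the tree, of the rank of the partition whose one part is the
set of vertices in leaves of the subtree of `x`. -/
noncomputable def BinTree.width (H : Hypergraph) : BinTree H.carrier → ℕ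
  | .leaf v => H.cutRank {v}
  | .node l r => max (H.cutRank {v | v ∈ (BinTree.node l r).leaves}) (max (l.width H) (r.width H))

/-- The minimum width of a tree decomposition. -/
noncomputable def Str.hyperRankwidth (H : Hypergraph) : ℕ :=
  sInf {k : ℕ | ∃ T : BinTree H.carrier, T.IsDecomposition ∧ T.width H = k}

theorem BinTree.exists_leaves_eq {V : Type} (L : List V) (hL : L ≠ []) :
    ∃ T : BinTree V, T.leaves = L := by
  induction L with
  | nil => exact absurd rfl hL
  | cons a L ih =>
    by_cases h : L = []
    · exact ⟨.leaf a, by simp [leaves, h]⟩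
    · obtain ⟨T, hT⟩ := ih h
      exact ⟨.node (.leaf a) T, by simp [leaves, hT]⟩

/-- Every hypergraph has a tree decomposition, so the minimum is over a nonempty set. -/
theorem Str.hyperRankwidth_attained (H : Hypergraph) :
    ∃ T : BinTree H.carrier, T.IsDecomposition ∧ T.width H = H.hyperRankwidth := by
  have := H.finite_carrier
  have := H.nonempty_carrier
  let := Fintype.ofFinite H.carrier
  obtain ⟨T, hT⟩ := BinTree.exists_leaves_eq (Finset.univ : Finset H.carrier).toList
    (by simp [Finset.univ_eq_empty_iff])
  have hd : T.IsDecomposition := ⟨hT ▸ Finset.nodup_toList _, fun v => by simp [hT]⟩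
  exact Nat.sInf_mem (s := {k : ℕ | ∃ T : BinTree H.carrier, T.IsDecomposition ∧ T.width H = k})
    ⟨_, T, hd, rfl⟩

def StrClass.BoundedHyperRankwidth (C : StrClass hypergraphVocab) : Prop :=
  ∃ k : ℕ, ∀ H : Hypergraph, C.Mem H → H.hyperRankwidth ≤ k

end MSO

/-! Both directions rest on a finiteness condition at cuts. A relation has finite index at a set U
if its truth depends only on the trace of the tuple outside U and on a value, in a fixed finite set
Q, computed from the trace on U (`Factors`). For a hypergraph this bounds the number of distinct
rows of the cut matrix. Over the two-element field, bounded rank and boundedly many distinct rows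
are the same thing: the rank is at most the number of distinct rows, and rank k allows at most 2^k
of them.

From width to rankwidth, the argument is the composition method. Finite index passes from the
relations of a structure to every MSO formula, with a value set that depends on the formula but not
on the structure or the cut (`Formula.exists_factors`). Hence having decompositions with uniformly
bounded index at all cuts is preserved by every transduction (`BoundedIndex.transduction`). Trees
have such decompositions, along subtrees and unions of sibling subtrees (`boundedIndex_isTree`), and
`Str.cutRank_le_card` converts index into rank.

From rankwidth to width, the argument is of Myhill–Nerode type. The row class of X at a node is
determined by its classes at the two children, so a decomposition of width at most k carries a
deterministic bottom-up automaton with 2^k states that recognises the hyperedges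
(`BinTree.exists_auto`, `Str.exists_auto`). A colouring writes the local data of the automaton on
the nodes, including which children are left ones, since the trees are unordered. An interpretation
then keeps the leaves and expresses acceptance in MSO. The input set is accepted when every family
of state sets closed under the transitions meets an accepting state; the run is the least such
family (`Auto.sat_accepted`). -/

namespace MSO

/-! ### Traces of tuples -/

/-- `a.Has x`: the object `a` is the element `x`, or a set that contains `x`. -/
def Val.Has {A : Type} (x : A) : {κ : Kind} → Val A κ → Prop
  | .elem, a => a = x
  | .set, X => x ∈ (X : Set A)

theorem Val.ext_has {A : Type} {κ : Kind} {a b : Val A κ}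
    (h : ∀ x, Val.Has x a ↔ Val.Has x b) : a = b := by
  cases κ with
  | elem => exact ((h a).1 rfl).symm
  | set => exact Set.ext h

theorem Val.has_map {A B : Type} {f : A → B} {κ : Kind} {a : Val A κ} {y : B} :
    Val.Has y (Val.map f a) ↔ ∃ x, Val.Has x a ∧ f x = y := by
  cases κ with
  | elem => simp [Val.Has, Val.map]
  | set => rfl

theorem Val.has_map_apply {A B : Type} {f : A → B} (hf : f.Injective) {κ : Kind} {a : Val A κ}
    {x : A} : Val.Has (f x) (Val.map f a) ↔ Val.Has x a := by
  rw [Val.has_map]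
  exact ⟨fun ⟨y, hy, h⟩ => hf h ▸ hy, fun h => ⟨x, h, rfl⟩⟩

/-- Two objects have the same trace on `U`. -/
def Val.Agree {A : Type} (U : Set A) {κ : Kind} (a b : Val A κ) : Prop :=
  ∀ x ∈ U, Val.Has x a ↔ Val.Has x b

/-- Two tuples have the same trace on `U`. -/
def Tuple.Agree {A : Type} (U : Set A) {Γ : List Kind} (s t : Tuple A Γ) : Prop :=
  ∀ κ v, Val.Agree U (s κ v) (t κ v)

theorem Val.Agree.symm {A : Type} {U : Set A} {κ : Kind} {a b : Val A κ} (h : Val.Agree U a b) :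
    Val.Agree U b a := fun x hx => (h x hx).symm

theorem Val.Agree.trans {A : Type} {U : Set A} {κ : Kind} {a b c : Val A κ}
    (h : Val.Agree U a b) (h' : Val.Agree U b c) : Val.Agree U a c :=
  fun x hx => (h x hx).trans (h' x hx)

theorem Tuple.Agree.symm {A : Type} {U : Set A} {Γ : List Kind} {s t : Tuple A Γ}
    (h : s.Agree U t) : t.Agree U s := fun κ v => (h κ v).symm

theorem Tuple.Agree.eq {A : Type} {U : Set A} {Γ : List Kind} {s t : Tuple A Γ}
    (h : s.Agree U t) (h' : s.Agree Uᶜ t) : s = t := by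
  funext κ v
  refine Val.ext_has fun x => ?_
  by_cases hx : x ∈ U
  · exact h κ v x hx
  · exact h' κ v x hx

theorem Val.Agree.eq_of_mem {A : Type} {U : Set A} {a b : Val A .elem} (h : Val.Agree U a b)
    (ha : a ∈ U) : b = a := (h a ha).1 rfl

theorem Tuple.Agree.elem {A : Type} {U : Set A} {Γ : List Kind} {s t : Tuple A Γ}
    (h : s.Agree U t) (v : Var Γ .elem) :
    (s .elem v : A) = t .elem v ∨ (s .elem v : A) ∉ U ∧ (t .elem v : A) ∉ U := by
  by_cases hs : (s .elem v : A) ∈ U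
  · exact .inl ((h .elem v).eq_of_mem hs).symm
  · by_cases ht : (t .elem v : A) ∈ U
    · exact .inl ((h .elem v).symm.eq_of_mem ht)
    · exact .inr ⟨hs, ht⟩

theorem Tuple.Agree.elem_compl {A : Type} {U : Set A} {Γ : List Kind} {s t : Tuple A Γ}
    (h : s.Agree Uᶜ t) (v : Var Γ .elem) :
    (s .elem v : A) = t .elem v ∨ (s .elem v : A) ∈ U ∧ (t .elem v : A) ∈ U := by
  simpa using h.elem v

theorem Tuple.Agree.cons {A : Type} {U : Set A} {κ : Kind} {Γ : List Kind} {a b : Val A κ}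
    {s t : Tuple A Γ} (hab : Val.Agree U a b) (h : s.Agree U t) :
    (Tuple.cons a s).Agree U (Tuple.cons b t) := by
  intro κ' v
  cases v with
  | zero => exact hab
  | succ v => exact h _ v

theorem Val.Agree.map {A B : Type} {f : A → B} (hf : f.Injective) {U : Set B} {κ : Kind}
    {a b : Val A κ} (h : Val.Agree (f ⁻¹' U) a b) : Val.Agree U (Val.map f a) (Val.map f b) := by
  intro y hy
  by_cases hr : ∃ x, f x = y
  · obtain ⟨x, rfl⟩ := hr
    rw [Val.has_map_apply hf, Val.has_map_apply hf]
    exact h x hy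
  · simp only [Val.has_map]
    constructor <;> rintro ⟨x, -, hx⟩ <;> exact absurd ⟨x, hx⟩ hr

theorem Val.Agree.of_map {A B : Type} {f : A → B} (hf : f.Injective) {U : Set B} {κ : Kind}
    {a b : Val A κ} (h : Val.Agree U (Val.map f a) (Val.map f b)) :
    Val.Agree (f ⁻¹' U) a b := fun x hx => by
  rw [← Val.has_map_apply hf, ← Val.has_map_apply hf (a := b)]
  exact h (f x) hx

/-- An object whose traces are those of objects in the range of a function is itself
in the range. -/
theorem Val.exists_map_eq {A B : Type} {f : A → B} {U : Set B} {κ : Kind} {w : Val B κ}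
    {a b : Val A κ} (ha : Val.Agree U w (Val.map f a)) (hb : Val.Agree Uᶜ w (Val.map f b)) :
    ∃ d : Val A κ, w = Val.map f d := by
  cases κ with
  | elem =>
    by_cases h : w ∈ U
    · exact ⟨a, (ha.eq_of_mem h).symm⟩
    · exact ⟨b, (hb.eq_of_mem h).symm⟩
  | set =>
    refine ⟨f ⁻¹' w, (Set.image_preimage_eq_of_subset fun y hy => ?_).symm⟩
    by_cases h : y ∈ U
    · obtain ⟨x, -, hx⟩ := (ha y h).1 hy
      exact ⟨x, hx⟩
    · obtain ⟨x, -, hx⟩ := (hb y h).1 hy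
      exact ⟨x, hx⟩

/-! ### Relations of finite index at a cut -/

/-- Whether `R` holds for a tuple depends only on the trace of the tuple outside `U` and on a
value in `Q` which is computed from the trace on `U`. -/
def Factors {A : Type} {Γ : List Kind} (Q : Type) (R : Tuple A Γ → Prop) (U : Set A) : Prop :=
  ∃ c : Tuple A Γ → Q, (∀ s t, s.Agree U t → c s = c t) ∧
    ∀ s t, c s = c t → s.Agree Uᶜ t → R s → R t

theorem Factors.comp_injective {A : Type} {Γ : List Kind} {Q Q' : Type} {R : Tuple A Γ → Prop}
    {U : Set A} (h : Factors Q R U) {g : Q → Q'} (hg : g.Injective) : Factors Q' R U := by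
  obtain ⟨c, h1, h2⟩ := h
  exact ⟨g ∘ c, fun s t hst => congrArg g (h1 s t hst), fun s t hst => h2 s t (hg hst)⟩

theorem Factors.preimage {A B : Type} {Γ : List Kind} {Q : Type} {R : Tuple B Γ → Prop}
    {U : Set B} (h : Factors Q R U) {f : A → B} (hf : f.Injective) :
    Factors Q (fun t : Tuple A Γ => R (t.map f)) (f ⁻¹' U) := by
  obtain ⟨c, h1, h2⟩ := h
  exact ⟨fun t => c (t.map f), fun s t hst => h1 _ _ fun κ v => (hst κ v).map hf,
    fun s t hst hc => h2 _ _ hst fun κ v => Val.Agree.map hf (U := Uᶜ) (hc κ v)⟩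

/-- A relation has finite index at a set that injects into a given finite set. -/
theorem Factors.of_injOn {A J : Type} {Γ : List Kind} (R : Tuple A Γ → Prop) {U : Set A}
    (f : A → J) (hf : U.InjOn f) : Factors ((κ : Kind) → Var Γ κ → Set J) R U := by
  -- The value is the whole trace on U, carried into J by f. Together with the trace outside U it
  -- determines the tuple.
  refine ⟨fun t κ v => {j | ∃ x ∈ U, f x = j ∧ Val.Has x (t κ v)}, fun s t h => ?_,
    fun s t h hc hs => ?_⟩
  · funext κ v
    ext j
    exact exists_congr fun x => and_congr_right fun hx => and_congr_right fun _ => h κ v x hx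
  · have key : ∀ s t : Tuple A Γ, (fun κ v => {j | ∃ x ∈ U, f x = j ∧ Val.Has x (s κ v)}) =
        (fun (κ : Kind) (v : Var Γ κ) => {j | ∃ x ∈ U, f x = j ∧ Val.Has x (t κ v)}) →
        ∀ κ v, ∀ x ∈ U, Val.Has x (s κ v) → Val.Has x (t κ v) := by
      intro s t h κ v x hx hs
      have : f x ∈ {j | ∃ x ∈ U, f x = j ∧ Val.Has x (t κ v)} := by
        rw [← congrFun (congrFun h κ) v]
        exact ⟨x, hx, rfl, hs⟩
      obtain ⟨y, hy, hxy, ht⟩ := this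
      exact hf hy hx hxy ▸ ht
    have : s = t := Tuple.Agree.eq (U := U)
      (fun κ v x hx => ⟨key s t h κ v x hx, key t s h.symm κ v x hx⟩) hc
    exact this ▸ hs

instance Kind.finite : Finite Kind :=
  Finite.of_surjective (fun b : Bool => if b then Kind.elem else Kind.set) fun κ => by
    cases κ
    exacts [⟨true, rfl⟩, ⟨false, rfl⟩]

instance Var.finite {Γ : List Kind} {κ : Kind} : Finite (Var Γ κ) := by
  induction Γ with
  | nil => exact Finite.of_injective (β := Empty) (fun v => nomatch v) fun v => nomatch v
  | cons κ' Γ ih =>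
    refine Finite.of_injective (β := Option (Var Γ κ))
      (fun v => match v with | .zero => none | .succ v => some v) fun v w h => ?_
    cases v <;> cases w <;> simp_all

/-- Cardinality is additive over the cut, and the trace outside U fixes the outer summand, so the
size of X ∩ U modulo p is enough. -/
theorem Factors.card {A : Type} [Finite A] {Γ : List Kind} (p : ℕ) [NeZero p] (X : Var Γ .set)
    (U : Set A) :
    Factors (ZMod p) (fun t : Tuple A Γ => p ∣ Set.ncard (α := A) (t .set X)) U := by
  refine ⟨fun t => (Set.ncard (α := A) ((t .set X : Set A) ∩ U) : ZMod p), fun s t h => ?_,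
    fun s t h hc hs => ?_⟩
  · have : (s .set X : Set A) ∩ U = (t .set X : Set A) ∩ U := by
      ext x
      exact and_congr_left fun hx => h .set X x hx
    simp only [this]
  · have hd : (s .set X : Set A) \ U = (t .set X : Set A) \ U := by
      ext x
      exact and_congr_left fun hx => hc .set X x hx
    beta_reduce at h hs ⊢
    rw [← ZMod.natCast_eq_zero_iff] at hs ⊢
    rw [← Set.ncard_inter_add_ncard_sdiff_eq_ncard _ U (Set.toFinite _), Nat.cast_add] at hs ⊢
    rw [← hd, ← h]
    exact hs

/-- Powerset construction: the value is the set of values reachable by some choice of witness. The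
extra bit records whether the witness meets U; without it an element witness inside U could be
exchanged for one outside, and the two could not be glued. -/
theorem Factors.ex {A : Type} {κ : Kind} {Γ : List Kind} {Q : Type}
    {R : Tuple A (κ :: Γ) → Prop} {U : Set A} (h : Factors Q R U) :
    Factors (Set (Q × Prop)) (fun t : Tuple A Γ => ∃ a, R (Tuple.cons a t)) U := by
  obtain ⟨c, h1, h2⟩ := h
  refine ⟨fun t => Set.range fun a => (c (Tuple.cons a t), ∃ x ∈ U, Val.Has x a),
    fun s t hst => ?_, fun s t h hc ⟨a, ha⟩ => ?_⟩
  · have : ∀ a, c (Tuple.cons a s) = c (Tuple.cons a t) := fun a =>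
      h1 _ _ (Tuple.Agree.cons (fun _ _ => Iff.rfl) hst)
    simp only [this]
  · have hm : (c (Tuple.cons a s), ∃ x ∈ U, Val.Has x a) ∈
        Set.range fun a => (c (Tuple.cons a t), ∃ x ∈ U, Val.Has x a) :=
      (Set.ext_iff.1 h _).1 ⟨a, rfl⟩
    obtain ⟨b, hb⟩ := hm
    obtain ⟨hb1, hb2⟩ := Prod.mk.inj hb
    -- The glued witness d looks like b on U and like a outside. For elements, the equal bits place
    -- a and b on the same side of the cut, so one of them serves as d.
    obtain ⟨d, hd1, hd2⟩ : ∃ d : Val A κ, Val.Agree U d b ∧ Val.Agree Uᶜ a d := by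
      cases κ with
      | elem =>
        have hU : b ∈ U ↔ a ∈ U := by simpa [Val.Has] using hb2
        by_cases hbU : b ∈ U
        · refine ⟨b, fun _ _ => Iff.rfl, fun x hx => ⟨fun h => ?_, fun h => ?_⟩⟩
          · exact absurd (h ▸ hU.1 hbU) hx
          · exact absurd (h ▸ hbU) hx
        · refine ⟨a, fun x hx => ⟨fun h => ?_, fun h => ?_⟩, fun _ _ => Iff.rfl⟩
          · exact absurd (hU.2 (h ▸ hx)) hbU
          · exact absurd (h ▸ hx) hbU
      | set =>
        refine ⟨((b : Set A) ∩ U ∪ (a : Set A) \ U : Set A), fun x hx => ?_, fun x hx => ?_⟩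
        · simp [Val.Has, hx]
        · have : x ∉ U := hx
          simp [Val.Has, this]
    refine ⟨d, h2 _ _ ?_ (Tuple.Agree.cons hd2 hc) ha⟩
    rw [← hb1]
    exact h1 _ _ (Tuple.Agree.cons hd1.symm fun _ _ _ _ => Iff.rfl)

/-- No pair of p leaves U, and all pairs that enter U start at the single element v. A crossing pair
is therefore recognised from inside U by testing whether v is related to the second component; this
is the fourth entry of the value. -/
theorem Factors.binary {A : Type} {Γ : List Kind} (p : A → A → Prop) (U : Set A)
    (hclosed : ∀ a b, p a b → a ∈ U → b ∈ U) (x y : Var Γ .elem) (v : A)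
    (hv : ∀ a b, p a b → b ∈ U → a ∉ U → a = v) :
    Factors (Prop × Prop × Prop × Prop) (fun t : Tuple A Γ => p (t .elem x) (t .elem y)) U := by
  refine ⟨fun t => ((t .elem x : A) ∈ U, (t .elem y : A) ∈ U,
    (t .elem x : A) ∈ U ∧ (t .elem y : A) ∈ U ∧ p (t .elem x) (t .elem y),
    (t .elem y : A) ∈ U ∧ p v (t .elem y)), fun s t h => ?_, fun s t h hc hs => ?_⟩
  · rcases h.elem x with hx | ⟨hx, hx'⟩ <;> rcases h.elem y with hy | ⟨hy, hy'⟩ <;> simp [*]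
  · simp only [Prod.mk.injEq] at h
    obtain ⟨-, -, h3, h4⟩ := h
    beta_reduce at hs ⊢
    by_cases hx : (s .elem x : A) ∈ U
    · exact (h3.mp ⟨hx, hclosed _ _ hs hx, hs⟩).2.2
    · obtain hxt : (s .elem x : A) = t .elem x := (hc.elem_compl x).resolve_right fun h => hx h.1
      by_cases hy : (s .elem y : A) ∈ U
      · have hsv := hv _ _ hs hy hx
        rw [hsv] at hs
        have := (h4.mp ⟨hy, hs⟩).2
        rwa [← hsv, hxt] at this
      · obtain hyt : (s .elem y : A) = t .elem y := (hc.elem_compl y).resolve_right fun h => hy h.1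
        rw [← hxt, ← hyt]
        exact hs

theorem Factors.unary {A : Type} {Γ : List Kind} (p : A → Prop) (x : Var Γ .elem) (U : Set A) :
    Factors (Prop × Prop) (fun t : Tuple A Γ => p (t .elem x)) U := by
  refine ⟨fun t => ((t .elem x : A) ∈ U, (t .elem x : A) ∈ U ∧ p (t .elem x)), fun s t h => ?_,
    fun s t h hc hs => ?_⟩
  · rcases h.elem x with hx | ⟨hx, hx'⟩ <;> simp [*]
  · obtain ⟨h1, h2⟩ := Prod.mk.inj h
    by_cases hx : (s .elem x : A) ∈ U
    · exact (h2.mp ⟨hx, hs⟩).2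
    · obtain hxt : (s .elem x : A) = t .elem x := (hc.elem_compl x).resolve_right fun h => hx h.1
      rw [← hxt]
      exact hs

/-- If the relations of a structure have bounded index at a cut, then so has every formula. -/
theorem Formula.exists_factors {σ : Vocab} (Q : σ.Rel → Type) (hQ : ∀ r, Finite (Q r))
    {Γ : List Kind} (φ : Formula σ Γ) : ∃ Q' : Type, Finite Q' ∧ ∀ (A : Str σ) (U : Set A.carrier),
      (∀ r, Factors (Q r) (A.rel r) U) → Factors Q' (φ.Sat A) U := by
  induction φ with
  | @eq Γ x y =>
    -- Equal elements never lie on opposite sides of a cut, so any element can play the role of v.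
    exact ⟨Prop × Prop × Prop × Prop, inferInstance, fun A U _ => Factors.binary (· = ·) U
      (fun x y hxy hx => hxy ▸ hx) x y A.nonempty_carrier.some (fun _ _ hxy hy hx => absurd hy (hxy ▸ hx))⟩
  | @mem Γ x X =>
    refine ⟨Prop × Prop, inferInstance, fun A U _ => ⟨fun t =>
      ((t .elem x : A.carrier) ∈ U, (t .elem x : A.carrier) ∈ U ∧
      (t .elem x : A.carrier) ∈ (t .set X : Set A.carrier)),
      fun s t h => ?_, fun s t h hc hs => ?_⟩⟩
    · have hX : ∀ a ∈ U, a ∈ (s .set X : Set A.carrier) ↔ a ∈ (t .set X : Set A.carrier) :=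
        fun a ha => h .set X a ha
      rcases h.elem x with h | ⟨h, h'⟩
      · simp +contextual [h, hX]
      · simp [h, h']
    · have hX : ∀ a ∉ U, a ∈ (s .set X : Set A.carrier) ↔ a ∈ (t .set X : Set A.carrier) :=
        fun a ha => hc .set X a ha
      obtain ⟨h1, h2⟩ := Prod.mk.inj h
      change (s .elem x : A.carrier) ∈ (s .set X : Set A.carrier) at hs
      by_cases hU : (s .elem x : A.carrier) ∈ U
      · exact (h2.mp ⟨hU, hs⟩).2
      · rcases hc.elem_compl x with h | ⟨h, -⟩
        · change (t .elem x : A.carrier) ∈ (t .set X : Set A.carrier)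
          rw [← h]
          exact (hX _ hU).1 hs
        · exact absurd h hU
  | rel r args =>
    refine ⟨Q r, hQ r, fun A U h => ?_⟩
    obtain ⟨c, h1, h2⟩ := h r
    exact ⟨fun t => c fun κ v => t κ (args κ v), fun s t hst => h1 _ _ fun κ v => hst κ _,
      fun s t hst hc => h2 _ _ hst fun κ v => hc κ _⟩
  | card p hp X =>
    have : NeZero p := ⟨by omega⟩
    refine ⟨ZMod p, inferInstance, fun A U _ => ?_⟩
    have := A.finite_carrier
    exact Factors.card p X U
  | not φ ih =>
    obtain ⟨Q', hQ', h⟩ := ih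
    refine ⟨Q', hQ', fun A U hA => ?_⟩
    obtain ⟨c, h1, h2⟩ := h A U hA
    exact ⟨c, h1, fun s t hst hc hs ht => hs (h2 t s hst.symm hc.symm ht)⟩
  | and φ ψ ih ih' =>
    obtain ⟨Q₁, hQ₁, h₁⟩ := ih
    obtain ⟨Q₂, hQ₂, h₂⟩ := ih'
    refine ⟨Q₁ × Q₂, inferInstance, fun A U hA => ?_⟩
    obtain ⟨c, hc1, hc2⟩ := h₁ A U hA
    obtain ⟨d, hd1, hd2⟩ := h₂ A U hA
    refine ⟨fun t => (c t, d t), fun s t h => ?_, fun s t h hc hs => ?_⟩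
    · exact Prod.ext (hc1 s t h) (hd1 s t h)
    · obtain ⟨h1, h2⟩ := Prod.mk.inj h
      exact ⟨hc2 s t h1 hc hs.1, hd2 s t h2 hc hs.2⟩
  | ex κ φ ih =>
    obtain ⟨Q', hQ', h⟩ := ih
    exact ⟨Set (Q' × Prop), inferInstance, fun A U hA => (h A U hA).ex⟩

/-! ### Decompositions -/

/-- `S` is empty or has a binary tree decomposition in which the sets at all the nodes
satisfy `P`. -/
inductive Built {A : Type} (P : Set A → Prop) : Set A → Prop
  | empty : Built P ∅
  | single (a : A) : P {a} → Built P {a}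
  | union (S T : Set A) : Disjoint S T → Built P S → Built P T → P (S ∪ T) → Built P (S ∪ T)

theorem Built.mono {A : Type} {P P' : Set A → Prop} (h : ∀ U, P U → P' U) {S : Set A}
    (hS : Built P S) : Built P' S := by
  induction hS with
  | empty => exact .empty
  | single a ha => exact .single a (h _ ha)
  | union S T hd _ _ hP h1 h2 => exact .union S T hd h1 h2 (h _ hP)

/-- Leaves outside the range of f disappear. This is why `Built` admits the empty set, without
requiring P of it. -/
theorem Built.preimage {A B : Type} {P : Set B → Prop} {P' : Set A → Prop} {f : A → B}
    (hf : f.Injective) (h : ∀ U, P U → P' (f ⁻¹' U)) {S : Set B} (hS : Built P S) :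
    Built P' (f ⁻¹' S) := by
  induction hS with
  | empty => exact .empty
  | single b hb =>
    by_cases hr : ∃ a, f a = b
    · obtain ⟨a, rfl⟩ := hr
      have : f ⁻¹' {f a} = {a} := by ext; simp [hf.eq_iff]
      rw [this]
      exact .single a (this ▸ h _ hb)
    · have : f ⁻¹' {b} = ∅ := by
        ext a
        simpa using fun ha => hr ⟨a, ha⟩
      rw [this]
      exact .empty
  | union S T hd _ _ hP h1 h2 => exact .union _ _ (hd.preimage f) h1 h2 (h _ hP)

theorem Built.of_finite {A : Type} {P : Set A → Prop} {S : Set A} (hS : S.Finite)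
    (h : ∀ U ⊆ S, P U) : Built P S := by
  induction S, hS using Set.Finite.induction_on with
  | empty => exact .empty
  | @insert a S ha _ ih =>
    rw [← Set.singleton_union] at h ⊢
    exact .union _ _ (Set.disjoint_singleton_left.2 ha) (.single a (h _ (by simp)))
      (ih fun U hU => h U (hU.trans Set.subset_union_right)) (h _ subset_rfl)

/-- Each leaf a is replaced by a decomposition of its fibre {a} × J. The new cuts are either full
preimages of old cuts or subsets of one fibre. -/
theorem Built.preimage_fst {A J : Type} [Finite J] {P : Set A → Prop} {P' : Set (A × J) → Prop}
    (h : ∀ U, P U → P' (Prod.fst ⁻¹' U)) (h' : ∀ a, ∀ U ⊆ Prod.fst ⁻¹' {a}, P' U) {S : Set A}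
    (hS : Built P S) : Built P' (Prod.fst ⁻¹' S) := by
  induction hS with
  | empty => exact .empty
  | single a _ =>
    refine Built.of_finite ?_ (h' a)
    have : (Prod.fst ⁻¹' {a} : Set (A × J)) = Set.range fun j => (a, j) := by
      ext ⟨b, j⟩
      simp [eq_comm]
    rw [this]
    exact Set.finite_range _
  | union S T hd _ _ hP h1 h2 => exact .union _ _ (hd.preimage _) h1 h2 (h _ hP)

/-! ### Transductions preserve bounded index -/

/-- The structures in `C` have decompositions at all of whose cuts the relations have
bounded index. -/
def BoundedIndex {σ : Vocab} (C : Str σ → Prop) : Prop :=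
  ∃ Q : σ.Rel → Type, (∀ r, Finite (Q r)) ∧
    ∀ A, C A → Built (fun U => ∀ r, Factors (Q r) (A.rel r) U) Set.univ

theorem BoundedIndex.iso {σ : Vocab} {C : Str σ → Prop} (h : BoundedIndex C) :
    BoundedIndex fun B => ∃ A, C A ∧ A.Iso B := by
  obtain ⟨Q, hQ, h⟩ := h
  refine ⟨Q, hQ, fun B ⟨A, hA, e, he⟩ => ?_⟩
  refine Built.preimage (S := Set.univ) e.symm.injective (fun U hU r => ?_) (h A hA)
  convert (hU r).preimage e.symm.injective using 1
  funext t
  rw [he]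
  congr!
  funext κ v
  refine Val.ext_has fun x => ?_
  obtain ⟨y, rfl⟩ := e.surjective x
  change _ ↔ Val.Has (e y) (Val.map e (Val.map e.symm (t κ v)))
  rw [Val.has_map_apply e.injective]
  conv_rhs => rw [← e.symm_apply_apply y]
  rw [Val.has_map_apply e.symm.injective]

/-- The new relations are formulas restricted to a subset of the universe: `Formula.exists_factors`
bounds their index on the input, and restricting the decomposition to the subset keeps the bound. -/
theorem BoundedIndex.interpretation {σ τ : Vocab} {C : Str σ → Prop} (h : BoundedIndex C)
    (I : Interpretation σ τ) :
    BoundedIndex fun B => ∃ A, C A ∧ ∃ h : Nonempty (I.Universe A), B = I.output A h := by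
  obtain ⟨Q, hQ, h⟩ := h
  choose Q' hQ' h' using fun r => (I.rel r).exists_factors Q hQ
  refine ⟨Q', hQ', ?_⟩
  rintro _ ⟨A, hA, hne, rfl⟩
  exact Built.preimage (S := Set.univ) Subtype.val_injective
    (fun U hU r => (h' r A U hU).preimage Subtype.val_injective) (h A hA)

theorem BoundedIndex.colouring {σ : Vocab} {C : Str σ → Prop} (h : BoundedIndex C) (k : ℕ) :
    BoundedIndex fun B => ∃ A, C A ∧ ∃ c : A.carrier → Fin k, B = A.colour k c := by
  obtain ⟨Q, hQ, h⟩ := h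
  refine ⟨fun | .inl r => Q r | .inr _ => Prop × Prop, ?_, ?_⟩
  · rintro (r | i)
    exacts [hQ r, inferInstanceAs (Finite (Prop × Prop))]
  · rintro _ ⟨A, hA, c, rfl⟩
    refine (h A hA).mono fun U hU r => ?_
    rcases r with r | i
    · exact hU r
    · exact Factors.unary (Γ := [.elem]) (fun a => c a = i) .zero U

/-- For each copy i, the value collects the old values of the tuples whose i-th copy has the same
trace over U as t. By `h1` this set has at most one element; it is empty if the inner trace does not
come from copy i. -/
theorem Factors.copy {A : Type} {Γ : List Kind} {Q : Type} {R : Tuple A Γ → Prop} {U : Set A}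
    (h : Factors Q R U) (J : Type) :
    Factors (J → Set Q) (fun t : Tuple (A × J) Γ =>
      ∃ (i : J) (s : Tuple A Γ), R s ∧ t = s.map fun a => (a, i)) (Prod.fst ⁻¹' U) := by
  obtain ⟨c, h1, h2⟩ := h
  have hinj : ∀ i : J, (fun a : A => (a, i)).Injective := fun i a b h => (Prod.mk.inj h).1
  refine ⟨fun t i => {q | ∃ s : Tuple A Γ, t.Agree (Prod.fst ⁻¹' U) (s.map fun a => (a, i)) ∧
    c s = q}, fun s t hst => ?_, ?_⟩
  · funext i
    ext q
    refine exists_congr fun u => and_congr_left fun _ => ?_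
    exact ⟨fun h κ v => (hst κ v).symm.trans (h κ v), fun h κ v => (hst κ v).trans (h κ v)⟩
  · rintro _ t h hc ⟨i, s, hs, rfl⟩
    have : c s ∈ {q | ∃ s : Tuple A Γ, t.Agree (Prod.fst ⁻¹' U) (s.map fun a => (a, i)) ∧
        c s = q} := by
      refine (Set.ext_iff.1 (congrFun h i) _).1 ?_
      exact ⟨s, fun _ _ _ _ => Iff.rfl, rfl⟩
    obtain ⟨u, hu, hus⟩ := this
    -- Over U the tuple t looks like u in copy i, and elsewhere like s in copy i. Hence t lies
    -- entirely in copy i.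
    choose d hd using fun κ v => Val.exists_map_eq (hu κ v) (hc.symm κ v)
    obtain rfl : t = Tuple.map (fun a => (a, i)) d := by
      funext κ v
      exact hd κ v
    refine ⟨i, d, h2 s d ?_ (fun κ v => ?_) hs, rfl⟩
    · rw [← hus]
      exact (h1 d u fun κ v => Val.Agree.of_map (hinj i) (hu κ v)).symm
    · exact Val.Agree.of_map (hinj i) (hc κ v)

/-- The cut is a union of fibres, so all copies of the witness a lie on the same side. Inside, the
value reports that a witness exists; outside, the outer trace already shows it. -/
theorem Factors.copies {A : Type} {k : ℕ} {Γ : List Kind} (U : Set A) :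
    Factors (Prop × Prop) (fun t : Tuple (A × Fin k) Γ =>
      ∃ a : A, ∀ (v : Var Γ .elem) (i : Fin k), (i : ℕ) = v.idx → t .elem v = (a, i))
      (Prod.fst ⁻¹' U) := by
  refine ⟨fun t => (∃ a ∈ U, ∀ (v : Var Γ .elem) (i : Fin k), (i : ℕ) = v.idx →
      t .elem v = (a, i), ∃ (v : Var Γ .elem) (i : Fin k), (i : ℕ) = v.idx ∧
      ∃ a ∈ U, ∃ j, t .elem v = (a, j)), fun s t h => ?_, ?_⟩
  · have hx : ∀ v, ∀ a ∈ U, ∀ j, s .elem v = (a, j) ↔ t .elem v = (a, j) :=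
      fun v a ha j => h .elem v (a, j) ha
    refine Prod.ext (propext (exists_congr fun a => and_congr_right fun ha => ?_))
      (propext (exists_congr fun v => exists_congr fun i => and_congr_right fun _ =>
        exists_congr fun a => and_congr_right fun ha => exists_congr fun j => hx v a ha j))
    exact forall_congr' fun v => forall_congr' fun i => imp_congr_right fun _ => hx v a ha i
  · rintro s t h hc ⟨a, ha⟩
    obtain ⟨h1, h2⟩ := Prod.mk.inj h
    by_cases haU : a ∈ U
    · obtain ⟨b, -, hb⟩ := h1.mp ⟨a, haU, ha⟩
      exact ⟨b, hb⟩
    · exact ⟨a, fun v i hi => (hc .elem v (a, i) haU).1 (ha v i hi)⟩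

theorem BoundedIndex.copying {σ : Vocab} {C : Str σ → Prop} (h : BoundedIndex C) (k : ℕ)
    (hk : 2 ≤ k) : BoundedIndex fun B => ∃ A, C A ∧ B = A.copy k hk := by
  obtain ⟨Q, hQ, h⟩ := h
  -- The left summands serve the cuts that are unions of fibres, the right ones the cuts inside one
  -- fibre, which embed in `Fin k`.
  refine ⟨fun
    | .inl r => (Fin k → Set (Q r)) ⊕ ((κ : Kind) → Var (σ.type r) κ → Set (Fin k))
    | .inr _ => (Prop × Prop) ⊕ ((κ : Kind) → Var (List.replicate k .elem) κ → Set (Fin k)),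
    ?_, ?_⟩
  · rintro (r | i)
    · exact inferInstanceAs (Finite (_ ⊕ _))
    · exact inferInstanceAs (Finite (_ ⊕ _))
  · rintro _ ⟨A, hA, rfl⟩
    refine Built.preimage_fst (S := Set.univ) (fun U hU r => ?_) (fun a U hU r => ?_) (h A hA)
    · rcases r with r | i
      · exact ((hU r).copy (Fin k)).comp_injective Sum.inl_injective
      · exact (Factors.copies U).comp_injective Sum.inl_injective
    · have hinj : U.InjOn (Prod.snd : A.carrier × Fin k → Fin k) := fun x hx y hy hxy =>
        Prod.ext ((hU hx).trans (hU hy).symm) hxy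
      rcases r with r | i
      · exact (Factors.of_injOn _ _ hinj).comp_injective Sum.inr_injective
      · exact (Factors.of_injOn _ _ hinj).comp_injective Sum.inr_injective

theorem BoundedIndex.elementary {σ τ : Vocab} (e : Elementary σ τ) {C : Str σ → Prop}
    (h : BoundedIndex C) : BoundedIndex fun B => ∃ A, C A ∧ e.Out A B := by
  cases e with
  | interpretation I => exact h.interpretation I
  | filtering φ =>
    obtain ⟨Q, hQ, h⟩ := h
    exact ⟨Q, hQ, fun B ⟨A, hA, hB⟩ => hB.2 ▸ h A hA⟩
  | copying k hk => exact h.copying k hk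
  | colouring k hk => exact h.colouring k

theorem BoundedIndex.transduction {σ τ : Vocab} (f : Transduction σ τ) {C : Str σ → Prop}
    (h : BoundedIndex C) : BoundedIndex fun B => ∃ A, C A ∧ f.Out A B := by
  induction f with
  | nil => exact h.iso
  | cons e f ih =>
    obtain ⟨Q, hQ, h⟩ := ih (h.elementary e)
    exact ⟨Q, hQ, fun D ⟨A, hA, B, hB, hD⟩ => h D ⟨B, ⟨A, hA, hB⟩, hD⟩⟩

/-! ### Trees have bounded index -/

theorem Str.factors_parent (T : Str treeVocab) (U : Set T.carrier)
    (hclosed : ∀ x y, T.Parent x y → x ∈ U → y ∈ U) (v : T.carrier)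
    (hv : ∀ x y, T.Parent x y → y ∈ U → x ∉ U → x = v) (r : Unit) :
    Factors (Prop × Prop × Prop × Prop) (T.rel r) U := by
  have key : ∀ t : Tuple T.carrier [.elem, .elem], T.rel r t ↔
      T.Parent (t .elem .zero) (t .elem (.succ .zero)) := by
    intro t
    have : t = Tuple.cons (κ := .elem) (t .elem .zero) (Tuple.cons (κ := .elem)
        (t .elem (.succ .zero)) Tuple.nil) := by
      funext κ v
      rcases v with _ | (_ | v)
      · rfl
      · rfl
      · exact nomatch v
    conv_lhs => rw [this]
    rfl
  have := Factors.binary (Γ := [.elem, .elem]) T.Parent U hclosed .zero (.succ .zero) v hv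
  simp only [← key] at this
  exact this

open Relation in
-- A subtree is its root together with the subtrees of the children, which are merged one at a time
-- because the tree is unranked. Every set that arises this way is closed under children and entered
-- from a single node. Singletons need not be closed, hence the separate hypothesis `hsingle`.
theorem Str.built_of_isTree {T : Str treeVocab} (hT : T.IsTree) {P : Set T.carrier → Prop}
    (hsingle : ∀ a, P {a})
    (h : ∀ (U : Set T.carrier) (v : T.carrier), (∀ x y, T.Parent x y → x ∈ U → y ∈ U) →
      (∀ x y, T.Parent x y → y ∈ U → x ∉ U → x = v) → P U) : Built P Set.univ := by
  obtain ⟨root, hroot, hpar, hreach⟩ := hT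
  have := T.finite_carrier
  have huniq : ∀ {x x' y}, T.Parent x y → T.Parent x' y → x = x' := fun {x x' y} hx hx' =>
    (hpar y fun hy => hroot x (hy ▸ hx)).unique hx hx'
  -- Induction along the path from the root: a cycle through a node also passes through its unique
  -- parent.
  have hacyc : ∀ y, ¬ TransGen T.Parent y y := by
    intro y
    induction hreach y with
    | refl =>
      intro hy
      obtain ⟨z, -, hz⟩ := TransGen.tail'_iff.1 hy
      exact hroot _ hz
    | tail _ hbc ih =>
      intro hy
      obtain ⟨z, hz, hzc⟩ := TransGen.tail'_iff.1 hy
      obtain rfl := huniq hzc hbc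
      exact ih (TransGen.head' hzc hz)
  have hchain : ∀ {x x' y}, ReflTransGen T.Parent x y → ReflTransGen T.Parent x' y →
      ReflTransGen T.Parent x x' ∨ ReflTransGen T.Parent x' x := by
    intro x x' y hx hx'
    have := ReflTransGen.total_of_right_unique (r := Function.swap T.Parent)
      (fun a b c hb hc => huniq hb hc) (reflTransGen_swap.2 hx) (reflTransGen_swap.2 hx')
    exact this.symm.imp reflTransGen_swap.1 reflTransGen_swap.1
  have hsib : ∀ {v c c'}, T.Parent v c → T.Parent v c' → ReflTransGen T.Parent c c' → c = c' := by
    intro v c c' hc hc' hcc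
    rcases ReflTransGen.cases_tail hcc with h | ⟨z, hz, hzc⟩
    · exact h.symm
    · obtain rfl := huniq hzc hc'
      exact absurd (TransGen.head' hc hz) (hacyc _)
  set D : T.carrier → Set T.carrier := fun v => {y | ReflTransGen T.Parent v y} with hD
  have hDclosed : ∀ v x y, T.Parent x y → x ∈ D v → y ∈ D v := fun v x y hxy hx => hx.tail hxy
  have hDup : ∀ v x y, T.Parent x y → y ∈ D v → x ∉ D v → y = v := by
    intro v x y hxy hy hx
    rcases ReflTransGen.cases_tail hy with h | ⟨z, hz, hzc⟩
    · exact h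
    · exact absurd (huniq hzc hxy ▸ hz) hx
  have main : ∀ n v, (D v).ncard = n → Built P (D v) := by
    intro n
    induction n using Nat.strong_induction_on with
    | _ n ih =>
    intro v hn
    have hchild : ∀ c, T.Parent v c → Built P (D c) := by
      intro c hc
      refine ih _ ?_ c rfl
      rw [← hn]
      refine Set.ncard_lt_ncard (Set.ssubset_iff_of_subset ?_ |>.2 ⟨v, .refl, ?_⟩) (Set.toFinite _)
      · exact fun y hy => ReflTransGen.head hc hy
      · exact fun hv => hacyc v (TransGen.head' hc hv)
    -- A union of subtrees of children of v is entered only from v.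
    have hchildren : ∀ s : Set T.carrier, s.Finite → (∀ c ∈ s, T.Parent v c) →
        Built P (⋃ c ∈ s, D c) := by
      intro s hs
      induction s, hs using Set.Finite.induction_on with
      | empty => simpa using Built.empty
      | @insert c s hc _ ih =>
        intro hs
        rw [Set.biUnion_insert]
        refine .union _ _ ?_ (hchild c (hs c (by simp))) (ih fun c' hc' => hs c' (by simp [hc']))
          (h _ v ?_ ?_)
        · rw [Set.disjoint_left]
          intro y hy hy'
          obtain ⟨c', hc', hy'⟩ := Set.mem_iUnion₂.1 hy'
          have hvc := hs c (by simp)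
          have hvc' := hs c' (by simp [hc'])
          rcases hchain hy hy' with h | h
          · exact hc (hsib hvc hvc' h ▸ hc')
          · exact hc (hsib hvc' hvc h ▸ hc')
        · rw [← Set.biUnion_insert]
          intro x y hxy hx
          obtain ⟨c', hc', hx⟩ := Set.mem_iUnion₂.1 hx
          exact Set.mem_iUnion₂.2 ⟨c', hc', hDclosed _ _ _ hxy hx⟩
        · rw [← Set.biUnion_insert]
          intro x y hxy hy hx
          obtain ⟨c', hc', hy⟩ := Set.mem_iUnion₂.1 hy
          obtain rfl := hDup c' x y hxy hy fun hx' => hx (Set.mem_iUnion₂.2 ⟨c', hc', hx'⟩)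
          exact huniq hxy (hs _ hc')
    have hDv : D v = {v} ∪ ⋃ c ∈ {c | T.Parent v c}, D c := by
      ext y
      simp only [Set.mem_union, Set.mem_singleton_iff, Set.mem_iUnion, hD, Set.mem_ofPred_eq]
      rw [ReflTransGen.cases_head_iff]
      simp [eq_comm]
    -- A subtree is entered only from the parent of its root v. If v has no parent, nothing enters,
    -- and v itself is passed as a dummy.
    have hP : P (D v) := by
      by_cases hv : ∃ w, T.Parent w v
      · obtain ⟨w, hw⟩ := hv
        refine h _ w (hDclosed v) fun x y hxy hy hx => ?_
        obtain rfl := hDup v x y hxy hy hx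
        exact huniq hxy hw
      · refine h _ v (hDclosed v) fun x y hxy hy hx => ?_
        obtain rfl := hDup v x y hxy hy hx
        exact absurd ⟨x, hxy⟩ hv
    rw [hDv] at hP ⊢
    refine .union _ _ ?_ (.single v (hsingle v)) (hchildren _ (Set.toFinite _) fun c hc => hc) hP
    rw [Set.disjoint_singleton_left]
    intro hv
    obtain ⟨c, hc, hv⟩ := Set.mem_iUnion₂.1 hv
    exact hacyc v (TransGen.head' hc hv)
  have : D root = Set.univ := Set.eq_univ_of_forall hreach
  exact this ▸ main _ root rfl

theorem boundedIndex_isTree : BoundedIndex Str.IsTree := by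
  -- The left summand serves the cuts formed from subtrees, the right one the singletons.
  refine ⟨fun _ => (Prop × Prop × Prop × Prop) ⊕
    ((κ : Kind) → Var [.elem, .elem] κ → Set Unit), fun _ => inferInstance, fun T hT => ?_⟩
  refine Str.built_of_isTree hT (fun a r => ?_) fun U v h1 h2 r => ?_
  · exact (Factors.of_injOn _ (fun _ => ()) (by simp)).comp_injective Sum.inr_injective
  · exact (T.factors_parent U h1 v h2 r).comp_injective Sum.inl_injective

/-! ### From bounded index to bounded hyper-rankwidth -/

/-- Two rows whose index sets have the same value in Q coincide, so there are at most |Q| distinct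
rows, and these span the row space. -/
theorem Str.cutRank_le_card {Q : Type} [Finite Q] {H : Hypergraph} {U : Set H.carrier}
    (h : Factors Q (H.rel ()) U) : H.cutRank U ≤ Nat.card Q := by
  classical
  have := H.finite_carrier
  obtain ⟨c, h1, h2⟩ := h
  -- The row attached to a value q, written existentially to avoid choosing a representative; it is
  -- zero if q is not attained.
  let g : Q → {Z : Set H.carrier // Z ⊆ Uᶜ} → ZMod 2 := fun q Z =>
    if ∃ X ⊆ U, c (Tuple.cons (κ := .set) X Tuple.nil) = q ∧ H.Hyperedge (X ∪ Z.1) then 1 else 0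
  have hcons : ∀ (V : Set H.carrier) (X Y : Set H.carrier), X ∩ V = Y ∩ V →
      Tuple.Agree V (Tuple.cons (κ := .set) X Tuple.nil) (Tuple.cons (κ := .set) Y Tuple.nil) := by
    intro V X Y hXY
    refine Tuple.Agree.cons (fun x hx => ?_) fun κ v => nomatch v
    exact ⟨fun h => (hXY.le ⟨h, hx⟩).1, fun h => (hXY.ge ⟨h, hx⟩).1⟩
  have hrow : ∀ X, (H.cutMatrix U).row X = g (c (Tuple.cons (κ := .set) X.1 Tuple.nil)) := by
    rintro ⟨X, hX⟩
    funext ⟨Z, hZ⟩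
    have : H.Hyperedge (X ∪ Z) ↔ ∃ Y ⊆ U, c (Tuple.cons (κ := .set) Y Tuple.nil) =
        c (Tuple.cons (κ := .set) X Tuple.nil) ∧ H.Hyperedge (Y ∪ Z) := by
      refine ⟨fun h => ⟨X, hX, rfl, h⟩, fun ⟨Y, hY, hc, h⟩ => ?_⟩
      have hU : ∀ Y ⊆ U, (Y ∪ Z) ∩ U = Y ∩ U := by
        intro Y _
        ext x
        have : x ∈ Z → x ∉ U := @hZ x
        simp only [Set.mem_inter_iff, Set.mem_union]
        tauto
      refine h2 _ _ ?_ (hcons Uᶜ (Y ∪ Z) (X ∪ Z) ?_) h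
      · rw [h1 _ _ (hcons U (Y ∪ Z) Y (hU Y hY)), h1 _ _ (hcons U (X ∪ Z) X (hU X hX)), hc]
      · ext x
        have := @hX x
        have := @hY x
        simp only [Set.mem_inter_iff, Set.mem_union, Set.mem_compl_iff]
        tauto
    simp only [Matrix.row, Str.cutMatrix, Matrix.of_apply, g, this]
  let := Fintype.ofFinite {Z : Set H.carrier // Z ⊆ Uᶜ}
  let := Fintype.ofFinite {X : Set H.carrier // X ⊆ U}
  let := Fintype.ofFinite Q
  have hle : (H.cutMatrix U).rank ≤ Fintype.card Q := by
    rw [Matrix.rank_eq_finrank_span_row]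
    refine (Submodule.finrank_mono (Submodule.span_mono (t := Set.range g) ?_)).trans
      (finrank_range_le_card g)
    rintro _ ⟨X, rfl⟩
    exact ⟨_, (hrow X).symm⟩
  rw [Nat.card_eq_fintype_card]
  exact hle

/-- A `BinTree` has no empty subtrees, so a union with an empty part is replaced by its other part.
-/
theorem Built.exists_binTree {H : Hypergraph} {k : ℕ} {P : Set H.carrier → Prop}
    (h : ∀ U, P U → H.cutRank U ≤ k) {S : Set H.carrier} (hS : Built P S) :
    S = ∅ ∨ ∃ T : BinTree H.carrier, T.leaves.Nodup ∧ {v | v ∈ T.leaves} = S ∧ T.width H ≤ k := by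
  induction hS with
  | empty => exact .inl rfl
  | single a ha => exact .inr ⟨.leaf a, by simp [BinTree.leaves], by simp [BinTree.leaves], h _ ha⟩
  | union S T hd _ _ hP ih1 ih2 =>
    rcases ih1 with rfl | ⟨T₁, hn₁, rfl, hw₁⟩
    · simpa using ih2
    rcases ih2 with rfl | ⟨T₂, hn₂, rfl, hw₂⟩
    · exact .inr ⟨T₁, hn₁, by simp, hw₁⟩
    have hl : {v | v ∈ (BinTree.node T₁ T₂).leaves} = {v | v ∈ T₁.leaves} ∪ {v | v ∈ T₂.leaves} := by
      ext v
      simp [BinTree.leaves]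
    refine .inr ⟨.node T₁ T₂, ?_, hl, ?_⟩
    · refine List.Nodup.append hn₁ hn₂ fun v h1 h2 => ?_
      exact Set.disjoint_left.1 hd h1 h2
    · rw [BinTree.width, hl]
      exact max_le (h _ hP) (max_le hw₁ hw₂)

theorem StrClass.BoundedMSOWidth.boundedHyperRankwidth {C : StrClass hypergraphVocab}
    (hC : C.BoundedMSOWidth) : C.BoundedHyperRankwidth := by
  obtain ⟨f, hf⟩ := hC
  obtain ⟨Q, hQ, h⟩ := boundedIndex_isTree.transduction f
  refine ⟨Nat.card (Q ()), fun H hH => ?_⟩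
  have := hQ ()
  have := H.nonempty_carrier
  rcases (h H (hf H hH)).exists_binTree (k := Nat.card (Q ()))
    (fun U hU => Str.cutRank_le_card (hU ())) with he | ⟨T, hn, hl, hw⟩
  · exact absurd he Set.univ_nonempty.ne_empty
  · exact le_trans (Nat.sInf_le ⟨T, ⟨hn, fun v => hl.ge (Set.mem_univ v)⟩, rfl⟩) hw

/-! ### From bounded hyper-rankwidth to automata -/

/-- A cut of rank at most `k` has at most `2 ^ k` classes of subsets. -/
theorem Str.exists_class_of_cutRank_le {H : Hypergraph} {U : Set H.carrier} {k : ℕ}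
    (h : H.cutRank U ≤ k) : ∃ c : Set H.carrier → Fin (2 ^ k), ∀ X Y, c X = c Y ↔
      ∀ Z, H.Hyperedge (X ∩ U ∪ Z \ U) ↔ H.Hyperedge (Y ∩ U ∪ Z \ U) := by
  classical
  have := H.finite_carrier
  let := Fintype.ofFinite {Z : Set H.carrier // Z ⊆ Uᶜ}
  let := Fintype.ofFinite {X : Set H.carrier // X ⊆ U}
  -- The row space has dimension at most k over a field with two elements, hence at most 2^k
  -- vectors. The class of X is its row, numbered by an injection of the row space.
  let W := Submodule.span (ZMod 2) (Set.range (H.cutMatrix U).row)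
  have hW : Nat.card W ≤ Nat.card (Fin (2 ^ k)) := by
    have : (H.cutMatrix U).rank ≤ k := h
    rw [Matrix.rank_eq_finrank_span_row] at this
    rw [Module.natCard_eq_pow_finrank (K := ZMod 2), Nat.card_zmod, Nat.card_fin]
    exact Nat.pow_le_pow_right two_pos this
  let g := (Finite.equivFin W).toEmbedding.trans (Fin.castLEEmb (hW.trans_eq (Nat.card_fin _)))
  refine ⟨fun X => g ⟨(H.cutMatrix U).row ⟨X ∩ U, Set.inter_subset_right⟩,
    Submodule.subset_span ⟨_, rfl⟩⟩, fun X Y => ?_⟩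
  rw [g.injective.eq_iff, Subtype.mk.injEq, funext_iff]
  have hite : ∀ p q : Prop, (if p then (1 : ZMod 2) else 0) = (if q then 1 else 0) ↔ (p ↔ q) := by
    intro p q
    by_cases hp : p <;> by_cases hq : q <;> simp [hp, hq]
  simp only [Matrix.row, Str.cutMatrix, Matrix.of_apply, hite]
  refine ⟨fun h Z => h ⟨Z \ U, fun x hx => hx.2⟩, fun h Z => ?_⟩
  have hZ : Z.1 \ U = Z.1 := sdiff_eq_left.2 (Set.disjoint_left.2 fun x hx => Z.2 hx)
  have := h Z.1
  rwa [hZ] at this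

/-- Deterministic automata that are tied to a binary tree with leaves in `V`. -/
inductive Auto (V Q : Type) where
  | leaf (v : V) (init : Prop → Q)
  | node (step : Q → Q → Q) (l r : Auto V Q)

def Auto.leaves {V Q : Type} : Auto V Q → List V
  | .leaf v _ => [v]
  | .node _ l r => l.leaves ++ r.leaves

/-- The state at the root, on a set of leaves. -/
def Auto.run {V Q : Type} (X : Set V) : Auto V Q → Q
  | .leaf v init => init (v ∈ X)
  | .node step l r => step (l.run X) (r.run X)

theorem inter_union_sdiff_of_disjoint {V : Type} {U W X Y Z : Set V} (h : Disjoint U W) :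
    X ∩ U ∪ (Y ∩ W ∪ Z \ (U ∪ W)) \ U = X ∩ U ∪ Y ∩ W ∪ Z \ (U ∪ W) := by
  have : (Y ∩ W ∪ Z \ (U ∪ W)) \ U = Y ∩ W ∪ Z \ (U ∪ W) :=
    sdiff_eq_left.2 <| Set.disjoint_left.2 fun x hx hU => hx.elim
      (fun hx => Set.disjoint_left.1 h hU hx.2) fun hx => hx.2 (.inl hU)
  rw [this, Set.union_assoc]

/-- States are the row classes at each cut, as in the Myhill–Nerode theorem. A transition is well
defined because equivalence at both children implies equivalence at the node. -/
theorem BinTree.exists_auto {H : Hypergraph} {k : ℕ} (T : BinTree H.carrier)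
    (hT : T.leaves.Nodup) (hw : T.width H ≤ k) :
    ∃ L : Auto H.carrier (Fin (2 ^ k)), L.leaves = T.leaves ∧ ∀ X Y, L.run X = L.run Y ↔
      ∀ Z, H.Hyperedge (X ∩ {v | v ∈ T.leaves} ∪ Z \ {v | v ∈ T.leaves}) ↔
        H.Hyperedge (Y ∩ {v | v ∈ T.leaves} ∪ Z \ {v | v ∈ T.leaves}) := by
  induction T with
  | leaf v =>
    obtain ⟨c, hc⟩ := Str.exists_class_of_cutRank_le hw
    have hl : {x | x ∈ (BinTree.leaf v).leaves} = {v} := by simp [BinTree.leaves]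
    -- The constant set {_x | p} is everything or empty, and at the cut {v} it stands for any X with
    -- v ∈ X ↔ p.
    refine ⟨.leaf v fun p => c {_x | p}, rfl, fun X Y => ?_⟩
    have hX : ∀ X : Set H.carrier, c {_x | v ∈ X} = c X := by
      intro X
      rw [hc]
      have : {_x | v ∈ X} ∩ {v} = X ∩ {v} := by
        ext x
        simp +contextual
      simp [this]
    simp only [Auto.run, hX, hl, hc]
  | node l r ihl ihr =>
    rw [BinTree.leaves, List.nodup_append'] at hT
    obtain ⟨hnl, hnr, hd⟩ := hT
    rw [BinTree.width, max_le_iff, max_le_iff] at hw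
    obtain ⟨L, hL, hcL⟩ := ihl hnl hw.2.1
    obtain ⟨R, hR, hcR⟩ := ihr hnr hw.2.2
    obtain ⟨c, hc⟩ := Str.exists_class_of_cutRank_le hw.1
    have hU : {v | v ∈ (BinTree.node l r).leaves} = {v | v ∈ l.leaves} ∪ {v | v ∈ r.leaves} := by
      ext v
      simp [BinTree.leaves]
    have hdisj : Disjoint {v | v ∈ l.leaves} {v | v ∈ r.leaves} :=
      Set.disjoint_left.2 fun x h h' => hd h h'
    rw [hU] at hc ⊢
    generalize {v | v ∈ l.leaves} = U at *
    generalize {v | v ∈ r.leaves} = W at *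
    -- First X ∩ U is exchanged for Y ∩ U while X ∩ W is kept, then X ∩ W for Y ∩ W while Y ∩ U is
    -- kept.
    have key : ∀ X Y, L.run X = L.run Y → R.run X = R.run Y → c X = c Y := by
      intro X Y h1 h2
      rw [hc]
      intro Z
      have h1 := (hcL X Y).1 h1 (X ∩ W ∪ Z \ (U ∪ W))
      have h2 := (hcR X Y).1 h2 (Y ∩ U ∪ Z \ (W ∪ U))
      rw [inter_union_sdiff_of_disjoint hdisj, inter_union_sdiff_of_disjoint hdisj] at h1
      rw [inter_union_sdiff_of_disjoint hdisj.symm, inter_union_sdiff_of_disjoint hdisj.symm,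
        Set.union_comm (X ∩ W), Set.union_comm (Y ∩ W), Set.union_comm W U] at h2
      rw [Set.inter_union_distrib_left, Set.inter_union_distrib_left]
      exact h1.trans h2
    classical
    -- Any set that realises both child states may represent the pair, by `key`. The default `c ∅`
    -- covers pairs that no set realises.
    let step : Fin (2 ^ k) → Fin (2 ^ k) → Fin (2 ^ k) := fun p q =>
      if h : ∃ X, L.run X = p ∧ R.run X = q then c h.choose else c ∅
    refine ⟨.node step L R, by simp [Auto.leaves, BinTree.leaves, hL, hR], fun X Y => ?_⟩
    have hstep : ∀ X, step (L.run X) (R.run X) = c X := by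
      intro X
      have h : ∃ Y, L.run Y = L.run X ∧ R.run Y = R.run X := ⟨X, rfl, rfl⟩
      simp only [step, dif_pos h]
      exact key _ _ h.choose_spec.1 h.choose_spec.2
    simp only [Auto.run, hstep, hc]

theorem Str.exists_auto {H : Hypergraph} {k : ℕ} (h : H.hyperRankwidth ≤ k) :
    ∃ (L : Auto H.carrier (Fin (2 ^ k))) (acc : Fin (2 ^ k) → Prop), L.leaves.Nodup ∧
      (∀ v, v ∈ L.leaves) ∧ ∀ X, H.Hyperedge X ↔ acc (L.run X) := by
  obtain ⟨T, ⟨hn, hv⟩, hT⟩ := H.hyperRankwidth_attained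
  obtain ⟨L, hL, hc⟩ := T.exists_auto hn (hT.trans_le h)
  -- At the root the cut is the whole vertex set, so two sets with the same state are both
  -- hyperedges or both not; one witness decides acceptance.
  refine ⟨L, fun q => ∃ X, L.run X = q ∧ H.Hyperedge X, hL ▸ hn, hL ▸ hv, fun X =>
    ⟨fun hX => ⟨X, rfl, hX⟩, fun ⟨Y, hY, hE⟩ => ?_⟩⟩
  have hU : {v | v ∈ T.leaves} = Set.univ := Set.eq_univ_of_forall hv
  have := (hc Y X).1 hY ∅
  simp only [hU, Set.inter_univ, Set.empty_sdiff, Set.union_empty] at this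
  exact this.1 hE

/-! ### Derived connectives -/

namespace Formula

variable {σ : Vocab} {Γ : List Kind} {A : Str σ}

def imp (φ ψ : Formula σ Γ) : Formula σ Γ := .not (.and φ (.not ψ))

def all (κ : Kind) (φ : Formula σ (κ :: Γ)) : Formula σ Γ := .not (.ex κ (.not φ))

def listConj : List (Formula σ Γ) → Formula σ Γ
  | [] => .all .elem (.eq .zero .zero)
  | φ :: l => .and φ (listConj l)

/-- The conjunction of a finite family. -/
noncomputable def conj {ι : Type} [Finite ι] (φ : ι → Formula σ Γ) : Formula σ Γ :=
  letI := Fintype.ofFinite ι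
  listConj ((Finset.univ : Finset ι).toList.map φ)

/-- The disjunction of a finite family. -/
noncomputable def disj {ι : Type} [Finite ι] (φ : ι → Formula σ Γ) : Formula σ Γ :=
  .not (conj fun i => .not (φ i))

variable {t : Tuple A.carrier Γ}

@[simp] theorem sat_not {φ : Formula σ Γ} : φ.not.Sat A t ↔ ¬ φ.Sat A t := Iff.rfl

@[simp] theorem sat_and {φ ψ : Formula σ Γ} : (φ.and ψ).Sat A t ↔ φ.Sat A t ∧ ψ.Sat A t := Iff.rfl

@[simp] theorem sat_mem {x : Var Γ .elem} {X : Var Γ .set} : (mem x X : Formula σ Γ).Sat A t ↔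
    (t .elem x : A.carrier) ∈ (t .set X : Set A.carrier) := Iff.rfl

@[simp] theorem sat_ex_elem {φ : Formula σ (.elem :: Γ)} : (ex .elem φ).Sat A t ↔
    ∃ a : A.carrier, φ.Sat A (Tuple.cons (κ := .elem) a t) := Iff.rfl

@[simp] theorem sat_imp {φ ψ : Formula σ Γ} :
    (φ.imp ψ).Sat A t ↔ (φ.Sat A t → ψ.Sat A t) := by
  simp [imp]

@[simp] theorem sat_all_elem {φ : Formula σ (.elem :: Γ)} : (all .elem φ).Sat A t ↔
    ∀ a : A.carrier, φ.Sat A (Tuple.cons (κ := .elem) a t) := by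
  simp [all]

@[simp] theorem sat_listConj {l : List (Formula σ Γ)} :
    (listConj l).Sat A t ↔ ∀ φ ∈ l, φ.Sat A t := by
  induction l with
  | nil => simp [listConj, Formula.Sat]
  | cons φ l ih => simp [listConj, ih]

@[simp] theorem sat_conj {ι : Type} [Finite ι] {φ : ι → Formula σ Γ} :
    (conj φ).Sat A t ↔ ∀ i, (φ i).Sat A t := by
  simp [conj]

@[simp] theorem sat_disj {ι : Type} [Finite ι] {φ : ι → Formula σ Γ} :
    (disj φ).Sat A t ↔ ∃ i, (φ i).Sat A t := by
  simp [disj]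

end Formula

@[simp] theorem Tuple.cons_zero {A : Type} {κ : Kind} {Γ : List Kind} (a : Val A κ)
    (t : Tuple A Γ) : Tuple.cons a t κ .zero = a := rfl

@[simp] theorem Tuple.cons_succ {A : Type} {κ κ' : Kind} {Γ : List Kind} (a : Val A κ)
    (t : Tuple A Γ) (v : Var Γ κ') : Tuple.cons a t κ' (.succ v) = t κ' v := rfl

/-! ### Quantification over several sets -/

/-- The context extended by `n` set variables. -/
def setsCtx : ℕ → List Kind → List Kind
  | 0, Γ => Γ
  | n + 1, Γ => .set :: setsCtx n Γ

def Var.old {κ : Kind} {Γ : List Kind} : (n : ℕ) → Var Γ κ → Var (setsCtx n Γ) κ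
  | 0, v => v
  | n + 1, v => .succ (v.old n)

def Var.new {Γ : List Kind} : (n : ℕ) → Fin n → Var (setsCtx n Γ) .set
  | _ + 1, ⟨0, _⟩ => .zero
  | n + 1, ⟨i + 1, h⟩ => .succ (Var.new n ⟨i, Nat.lt_of_succ_lt_succ h⟩)

def Tuple.sets {A : Type} {Γ : List Kind} : (n : ℕ) → (Fin n → Set A) → Tuple A Γ →
    Tuple A (setsCtx n Γ)
  | 0, _, t => t
  | n + 1, X, t => Tuple.cons (κ := .set) (X 0) (Tuple.sets n (fun i => X i.succ) t)

@[simp] theorem Tuple.sets_old {A : Type} {κ : Kind} {Γ : List Kind} (n : ℕ) (X : Fin n → Set A)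
    (t : Tuple A Γ) (v : Var Γ κ) : Tuple.sets n X t κ (v.old n) = t κ v := by
  induction n with
  | zero => rfl
  | succ n ih => exact ih _

@[simp] theorem Tuple.sets_new {A : Type} {Γ : List Kind} (n : ℕ) (X : Fin n → Set A)
    (t : Tuple A Γ) (i : Fin n) : Tuple.sets n X t .set (Var.new n i) = X i := by
  induction n with
  | zero => exact i.elim0
  | succ n ih =>
    obtain ⟨i, hi⟩ := i
    cases i with
    | zero => rfl
    | succ i => exact ih _ ⟨i, Nat.lt_of_succ_lt_succ hi⟩

def Formula.exSets {σ : Vocab} {Γ : List Kind} : (n : ℕ) → Formula σ (setsCtx n Γ) → Formula σ Γ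
  | 0, φ => φ
  | n + 1, φ => Formula.exSets n (.ex .set φ)

@[simp] theorem Formula.sat_exSets {σ : Vocab} {Γ : List Kind} {A : Str σ} {n : ℕ}
    {φ : Formula σ (setsCtx n Γ)} {t : Tuple A.carrier Γ} :
    (Formula.exSets n φ).Sat A t ↔ ∃ X : Fin n → Set A.carrier, φ.Sat A (Tuple.sets n X t) := by
  induction n with
  | zero => exact ⟨fun h => ⟨Fin.elim0, h⟩, fun ⟨_, h⟩ => h⟩
  | succ n ih =>
    refine (ih (φ := .ex .set φ)).trans ⟨?_, ?_⟩
    · rintro ⟨X, Y, h⟩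
      exact ⟨Fin.cons Y X, h⟩
    · rintro ⟨X, h⟩
      exact ⟨fun i => X i.succ, X 0, h⟩

/-! ### Coloured trees -/

/-- The information about an automaton which is stored at a node of its tree. -/
structure Label (Q : Type) where
  isLeft : Prop
  isLeaf : Prop
  init : Prop → Q
  step : Q → Q → Q
  accept : Q → Prop

instance Label.finite {Q : Type} [Finite Q] : Finite (Label Q) :=
  Finite.of_injective
    (β := Prop × Prop × (Prop → Q) × (Q → Q → Q) × (Q → Prop))
    (fun a => (a.isLeft, a.isLeaf, a.init, a.step, a.accept)) fun a b h => by
      cases a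
      cases b
      simp_all

section Coloured

variable {n : ℕ}

/-- The vocabulary of trees whose nodes are coloured by labels. -/
noncomputable abbrev labelledVocab (n : ℕ) : Vocab :=
  treeVocab.addColours (Nat.card (Label (Fin n)))

def Str.LabelledParent (A : Str (labelledVocab n)) (x y : A.carrier) : Prop :=
  A.rel (.inl ()) (Tuple.cons (κ := .elem) x (Tuple.cons (κ := .elem) y Tuple.nil))

/-- The element `x` has a label that satisfies `p`. -/
def Str.HasLabel (A : Str (labelledVocab n)) (p : Label (Fin n) → Prop) (x : A.carrier) : Prop :=
  ∃ i : {a : Label (Fin n) // p a},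
    A.rel (.inr (Finite.equivFin (Label (Fin n)) i.1)) (Tuple.cons (κ := .elem) x Tuple.nil)

namespace Formula

variable {Γ : List Kind}

def parent (x y : Var Γ .elem) : Formula (labelledVocab n) Γ :=
  .rel (.inl ()) fun
    | _, .zero => x
    | _, .succ .zero => y

noncomputable def hasLabel (p : Label (Fin n) → Prop) (x : Var Γ .elem) :
    Formula (labelledVocab n) Γ :=
  .disj fun i : {a : Label (Fin n) // p a} =>
    .rel (.inr (Finite.equivFin (Label (Fin n)) i.1)) fun
      | _, .zero => x

variable {A : Str (labelledVocab n)} {t : Tuple A.carrier Γ}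

theorem sat_parent {x y : Var Γ .elem} :
    (parent x y).Sat A t ↔ A.LabelledParent (t .elem x) (t .elem y) := by
  apply iff_of_eq
  change A.rel (.inl ()) _ = A.rel (.inl ()) _
  congr 1
  funext κ v
  rcases v with _ | (_ | v)
  · rfl
  · rfl
  · exact nomatch v

theorem sat_hasLabel {p : Label (Fin n) → Prop} {x : Var Γ .elem} :
    (hasLabel p x).Sat A t ↔ A.HasLabel p (t .elem x) := by
  refine sat_disj.trans (exists_congr fun i => iff_of_eq ?_)
  change A.rel (.inr (Finite.equivFin (Label (Fin n)) i.1)) _ = A.rel (.inr _) _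
  congr 1
  funext κ v
  rcases v with _ | v
  · rfl
  · exact nomatch v

end Formula

/-- The sets `S q` contain the nodes with state `q`, if the automaton is started with the set `X`
of leaves. -/
def Str.ClosedUnder (A : Str (labelledVocab n)) (X : Set A.carrier)
    (S : Fin n → Set A.carrier) : Prop :=
  (∀ x q, (A.HasLabel (fun a => a.isLeaf ∧ a.init True = q) x → x ∈ X → x ∈ S q) ∧
    (A.HasLabel (fun a => a.isLeaf ∧ a.init False = q) x → x ∉ X → x ∈ S q)) ∧
    ∀ x y z, A.LabelledParent x y → A.LabelledParent x z → A.HasLabel Label.isLeft y →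
      ¬ A.HasLabel Label.isLeft z → ∀ p q r, y ∈ S p → z ∈ S q →
        A.HasLabel (fun a => a.step p q = r) x → x ∈ S r

namespace Formula

noncomputable def closedUnder : Formula (labelledVocab n) (setsCtx n [.set]) :=
  .and
    (.all .elem <| .conj fun q : Fin n => .and
      (.imp (.hasLabel (fun a => a.isLeaf ∧ a.init True = q) .zero) <|
        .imp (.mem .zero (.succ (.old n .zero))) (.mem .zero (.succ (.new n q))))
      (.imp (.hasLabel (fun a => a.isLeaf ∧ a.init False = q) .zero) <|
        .imp (.not (.mem .zero (.succ (.old n .zero)))) (.mem .zero (.succ (.new n q)))))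
    (.all .elem <| .all .elem <| .all .elem <|
      .imp (.parent (.succ (.succ .zero)) (.succ .zero)) <|
      .imp (.parent (.succ (.succ .zero)) .zero) <|
      .imp (.hasLabel Label.isLeft (.succ .zero)) <|
      .imp (.not (.hasLabel Label.isLeft .zero)) <|
      .conj fun p : Fin n => .conj fun q : Fin n => .conj fun r : Fin n =>
        .imp (.mem (.succ .zero) (.succ (.succ (.succ (.new n p))))) <|
        .imp (.mem .zero (.succ (.succ (.succ (.new n q))))) <|
        .imp (.hasLabel (fun a => a.step p q = r) (.succ (.succ .zero))) <|
          .mem (.succ (.succ .zero)) (.succ (.succ (.succ (.new n r)))))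

/-- The root need not be located by the formula: in the trees coloured by `Auto.label`, labels at
other nodes accept no state. -/
noncomputable def accepts : Formula (labelledVocab n) (setsCtx n [.set]) :=
  .ex .elem <| .disj fun q : Fin n =>
    .and (.hasLabel (fun a => a.accept q) .zero) (.mem .zero (.succ (.new n q)))

/-- The set of leaves `X` is accepted by the automaton. -/
noncomputable def accepted : Formula (labelledVocab n) [.set] :=
  .and (.all .elem <| .imp (.mem .zero (.succ .zero)) (.hasLabel Label.isLeaf .zero))
    (.not <| .exSets n <| .and .closedUnder (.not .accepts))

variable {A : Str (labelledVocab n)} {t : Tuple A.carrier [.set]} {S : Fin n → Set A.carrier}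

theorem sat_closedUnder :
    closedUnder.Sat A (Tuple.sets n S t) ↔ A.ClosedUnder (t .set .zero) S := by
  simp [closedUnder, Str.ClosedUnder, sat_hasLabel, sat_parent]

theorem sat_accepts : accepts.Sat A (Tuple.sets n S t) ↔
    ∃ x q, A.HasLabel (fun a => a.accept q) x ∧ x ∈ S q := by
  simp [accepts, sat_hasLabel]

theorem sat_accepted : accepted.Sat A t ↔
    (∀ x ∈ (t .set .zero : Set A.carrier), A.HasLabel Label.isLeaf x) ∧
      ∀ S, A.ClosedUnder (t .set .zero) S →
        ∃ x q, A.HasLabel (fun a => a.accept q) x ∧ x ∈ S q := by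
  simp [accepted, sat_hasLabel, sat_closedUnder, sat_accepts]

end Formula

/-- The hypergraph on the leaves whose hyperedges are the accepted sets. -/
noncomputable def acceptedInterpretation (n : ℕ) :
    Interpretation (labelledVocab n) hypergraphVocab where
  univ := .hasLabel Label.isLeaf .zero
  rel _ := .accepted
  -- The first conjunct of `accepted` confines hyperedges to the leaves, which form the new
  -- universe.
  consistent A r t h κ v := by
    cases v with
    | zero => exact fun a ha => Formula.sat_hasLabel.2 ((Formula.sat_accepted.1 h).1 a ha)
    | succ v => exact nomatch v

end Coloured

/-! ### The tree of an automaton -/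

section AutoTree

variable {V Q : Type}

/-- The subtree at a position, which is given by the path from the root. -/
def Auto.sub : List Bool → Auto V Q → Option (Auto V Q)
  | [], L => some L
  | _ :: _, .leaf _ _ => none
  | true :: p, .node _ l _ => Auto.sub p l
  | false :: p, .node _ _ r => Auto.sub p r

theorem Auto.sub_append (p q : List Bool) (L : Auto V Q) :
    L.sub (p ++ q) = (L.sub p).bind (Auto.sub q) := by
  induction p generalizing L with
  | nil => rfl
  | cons b p ih => cases L <;> cases b <;> simp [Auto.sub, ih]

theorem Auto.finite_positions (L : Auto V Q) : {p | (L.sub p).isSome}.Finite := by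
  induction L with
  | leaf v i =>
    refine (Set.finite_singleton []).subset fun p hp => ?_
    cases p with
    | nil => rfl
    | cons b p => simp [Auto.sub] at hp
  | node s l r ihl ihr =>
    refine (((ihl.image (List.cons true)).union (ihr.image (List.cons false))).insert
      []).subset fun p hp => ?_
    rcases p with _ | ⟨_ | _, p⟩
    · exact .inl rfl
    · exact .inr (.inr ⟨p, hp, rfl⟩)
    · exact .inr (.inl ⟨p, hp, rfl⟩)

theorem Auto.mem_leaves_iff {L : Auto V Q} {v : V} :
    v ∈ L.leaves ↔ ∃ p i, L.sub p = some (.leaf v i) := by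
  induction L with
  | leaf w i =>
    constructor
    · intro h
      obtain rfl := List.mem_singleton.1 h
      exact ⟨[], i, rfl⟩
    · rintro ⟨p, j, h⟩
      cases p with
      | nil =>
        obtain ⟨rfl, -⟩ := Auto.leaf.inj (Option.some.inj h)
        exact List.mem_singleton_self _
      | cons b p => simp [Auto.sub] at h
  | node s l r ihl ihr =>
    rw [Auto.leaves, List.mem_append, ihl, ihr]
    constructor
    · rintro (⟨p, i, h⟩ | ⟨p, i, h⟩)
      exacts [⟨true :: p, i, h⟩, ⟨false :: p, i, h⟩]
    · rintro ⟨p, i, h⟩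
      rcases p with _ | ⟨_ | _, p⟩
      · simp [Auto.sub] at h
      · exact .inr ⟨p, i, h⟩
      · exact .inl ⟨p, i, h⟩

/-- The two subtrees of a node share no leaf labels, so all occurrences of v lie on the same side at
every node. -/
theorem Auto.leaf_position_unique {L : Auto V Q} (hL : L.leaves.Nodup) {v : V} {p q : List Bool}
    {i j : Prop → Q} (hp : L.sub p = some (.leaf v i)) (hq : L.sub q = some (.leaf v j)) :
    p = q := by
  induction L generalizing p q with
  | leaf w k => cases p <;> cases q <;> simp_all [Auto.sub]
  | node s l r ihl ihr =>
    rw [Auto.leaves, List.nodup_append'] at hL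
    obtain ⟨hl, hr, hd⟩ := hL
    rcases p with _ | ⟨_ | _, p⟩ <;> rcases q with _ | ⟨_ | _, q⟩ <;>
      simp only [Auto.sub, Option.some.injEq, reduceCtorEq] at hp hq
    · rw [ihr hr hp hq]
    · exact (hd (Auto.mem_leaves_iff.2 ⟨_, _, hq⟩) (Auto.mem_leaves_iff.2 ⟨_, _, hp⟩)).elim
    · exact (hd (Auto.mem_leaves_iff.2 ⟨_, _, hp⟩) (Auto.mem_leaves_iff.2 ⟨_, _, hq⟩)).elim
    · rw [ihl hl hp hq]

/-- The nodes of the tree of an automaton. -/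
def Auto.Node (L : Auto V Q) : Type := {p : List Bool // (L.sub p).isSome}

def Auto.Node.sub {L : Auto V Q} (x : L.Node) : Auto V Q := (L.sub x.1).get x.2

theorem Auto.Node.sub_eq_iff {L : Auto V Q} {x : L.Node} {M : Auto V Q} :
    x.sub = M ↔ L.sub x.1 = some M :=
  ⟨fun h => h ▸ (Option.some_get x.2).symm, fun h => Option.get_of_mem x.2 h⟩

def Auto.root (L : Auto V Q) : L.Node := ⟨[], rfl⟩

/-- The child of a node, and the subtree at the child, in a given direction. -/
theorem Auto.Node.exists_child {L : Auto V Q} {x : L.Node} {s : Q → Q → Q} {l r : Auto V Q}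
    (h : x.sub = .node s l r) (b : Bool) :
    ∃ y : L.Node, y.1 = x.1 ++ [b] ∧ y.sub = if b then l else r := by
  have : L.sub (x.1 ++ [b]) = some (if b then l else r) := by
    rw [Auto.sub_append, Auto.Node.sub_eq_iff.1 h]
    cases b <;> rfl
  exact ⟨⟨x.1 ++ [b], by simp [this]⟩, rfl, Auto.Node.sub_eq_iff.2 this⟩

theorem Auto.Node.child_sub {L : Auto V Q} {x y : L.Node} {b : Bool} (h : y.1 = x.1 ++ [b]) :
    ∃ s l r, x.sub = .node s l r ∧ y.sub = if b then l else r := by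
  have hy : L.sub y.1 = some y.sub := Auto.Node.sub_eq_iff.1 rfl
  rw [h, Auto.sub_append, Auto.Node.sub_eq_iff.1 rfl] at hy
  cases hx : x.sub with
  | leaf v i => simp [hx, Auto.sub] at hy
  | node s l r =>
    refine ⟨s, l, r, rfl, ?_⟩
    cases b <;> simp_all [Auto.sub]

/-- The tree of an automaton. -/
def Auto.tree (L : Auto V Q) : Str treeVocab where
  carrier := L.Node
  finite_carrier := L.finite_positions.to_subtype
  nonempty_carrier := ⟨L.root⟩
  rel _ := fun t => ∃ b, (t .elem (.succ .zero) : L.Node).1 = (t .elem .zero : L.Node).1 ++ [b]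

theorem Auto.parent_tree {L : Auto V Q} {x y : L.Node} :
    L.tree.Parent x y ↔ ∃ b, y.1 = x.1 ++ [b] := Iff.rfl

theorem Auto.isTree_tree (L : Auto V Q) : L.tree.IsTree := by
  refine ⟨L.root, fun x hx => ?_, fun y hy => ?_, ?_⟩
  · obtain ⟨b, hb⟩ := Auto.parent_tree.1 hx
    simp [Auto.root] at hb
  · obtain ⟨p, hp⟩ := y
    rcases List.eq_nil_or_concat' p with rfl | ⟨p, b, rfl⟩
    · exact absurd rfl hy
    · have : (L.sub p).isSome := by
        rw [Auto.sub_append] at hp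
        exact Option.isSome_of_isSome_bind hp
      refine ⟨⟨p, this⟩, ⟨b, rfl⟩, fun z hz => ?_⟩
      obtain ⟨c, hc⟩ := Auto.parent_tree.1 hz
      exact Subtype.ext (List.append_inj' hc rfl).1.symm
  · rintro ⟨p, hp⟩
    induction p using List.reverseRecOn with
    | nil => exact .refl
    | append_singleton p b ih =>
      have : (L.sub p).isSome := by
        rw [Auto.sub_append] at hp
        exact Option.isSome_of_isSome_bind hp
      exact (ih this).tail ⟨b, rfl⟩

end AutoTree

/-! ### Labelled trees, and the run as the least closed family -/

section AutoLabel

variable {V : Type} {n : ℕ}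

/-- The label of a node; a root accepts according to `acc`. -/
noncomputable def Auto.label [Nonempty (Fin n)] (L : Auto V (Fin n)) (acc : Fin n → Prop)
    (x : L.Node) : Label (Fin n) where
  isLeft := x.1.getLast? = some true
  isLeaf := ∃ v i, x.sub = .leaf v i
  -- The arbitrary values are harmless: `ClosedUnder` reads `init` only together with `isLeaf`, and
  -- `step` only at nodes that have children.
  init := match x.sub with
    | .leaf _ init => init
    | .node _ _ _ => fun _ => Classical.arbitrary _
  step := match x.sub with
    | .leaf _ _ => fun _ _ => Classical.arbitrary _
    | .node step _ _ => step
  accept q := x.1 = [] ∧ acc q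

/-- The tree of an automaton, coloured by labels. -/
noncomputable def Auto.labelledTree [Nonempty (Fin n)] (L : Auto V (Fin n)) (acc : Fin n → Prop) :
    Str (labelledVocab n) :=
  L.tree.colour _ fun x => Finite.equivFin (Label (Fin n)) (L.label acc x)

variable [Nonempty (Fin n)] {L : Auto V (Fin n)} {acc : Fin n → Prop}

theorem Auto.hasLabel_labelledTree {p : Label (Fin n) → Prop} {x : L.Node} :
    (L.labelledTree acc).HasLabel p x ↔ p (L.label acc x) := by
  constructor
  · rintro ⟨i, hi⟩
    have : L.label acc x = i.1 := (Finite.equivFin (Label (Fin n))).injective hi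
    exact this ▸ i.2
  · exact fun h => ⟨⟨_, h⟩, rfl⟩

theorem Auto.labelledParent_labelledTree {x y : L.Node} :
    (L.labelledTree acc).LabelledParent x y ↔ ∃ b, y.1 = x.1 ++ [b] := Iff.rfl

/-- The nodes of the leaves in a set. -/
def Auto.leafNodes (L : Auto V (Fin n)) (X : Set V) : Set L.Node :=
  {x | ∃ v i, x.sub = .leaf v i ∧ v ∈ X}

/-- Applied to this family, the universal condition in `accepted` forces the actual run to accept.
-/
theorem Auto.closedUnder_run (X : Set V) :
    (L.labelledTree acc).ClosedUnder (L.leafNodes X) fun q => {x : L.Node | x.sub.run X = q} := by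
  have hinit : ∀ x : L.Node, (L.label acc x).isLeaf →
      x.sub.run X = (L.label acc x).init (x ∈ L.leafNodes X) := by
    rintro x ⟨v, i, hx⟩
    have : x ∈ L.leafNodes X ↔ v ∈ X := by
      constructor
      · rintro ⟨w, j, hw, hX⟩
        obtain ⟨rfl, -⟩ := Auto.leaf.inj (hx.symm.trans hw)
        exact hX
      · exact fun h => ⟨v, i, hx, h⟩
    simp only [this, Auto.label]
    rw [hx]
    rfl
  refine ⟨fun (x : L.Node) q => ⟨fun h hX => ?_, fun h hX => ?_⟩,
    fun (x y z : L.Node) hy hz hly hlz p q r hp hq hr => ?_⟩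
  · obtain ⟨h1, h2⟩ := Auto.hasLabel_labelledTree.1 h
    exact (hinit x h1).trans ((eq_true hX).symm ▸ h2)
  · obtain ⟨h1, h2⟩ := Auto.hasLabel_labelledTree.1 h
    exact (hinit x h1).trans ((eq_false hX).symm ▸ h2)
  · obtain ⟨b, hb⟩ := Auto.labelledParent_labelledTree.1 hy
    obtain ⟨c, hc⟩ := Auto.labelledParent_labelledTree.1 hz
    rw [Auto.hasLabel_labelledTree] at hly hlz hr
    obtain rfl : b = true := by simpa [Auto.label, hb] using hly
    obtain rfl : c = false := by simpa [Auto.label, hc] using hlz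
    obtain ⟨s, l, r', hs, hyl⟩ := Auto.Node.child_sub hb
    obtain ⟨_, _, _, hs', hzr⟩ := Auto.Node.child_sub hc
    obtain ⟨rfl, rfl, rfl⟩ := Auto.node.inj (hs.symm.trans hs')
    simp only [Auto.label] at hr
    rw [hs] at hr
    change y.sub.run X = p at hp
    change z.sub.run X = q at hq
    change x.sub.run X = r
    rw [hyl] at hp
    rw [hzr] at hq
    rw [hs, ← hr, ← hp, ← hq]
    rfl

/-- Minimality of the run, by induction on the subtree: every closed family contains it, so an
accepting run yields an accepting state in each closed family. -/
theorem Auto.mem_of_closedUnder {X : Set V} {S : Fin n → Set L.Node}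
    (hS : (L.labelledTree acc).ClosedUnder (L.leafNodes X) S) (M : Auto V (Fin n)) (x : L.Node)
    (hx : x.sub = M) : x ∈ S (M.run X) := by
  induction M generalizing x with
  | leaf v i =>
    have h1 : (L.label acc x).isLeaf := ⟨v, i, hx⟩
    have h2 : (L.label acc x).init = i := by
      simp only [Auto.label]
      rw [hx]
    by_cases hv : v ∈ X
    · refine (hS.1 x _).1 (Auto.hasLabel_labelledTree.2 ⟨h1, ?_⟩) ⟨v, i, hx, hv⟩
      simp [h2, Auto.run, hv]
    · refine (hS.1 x _).2 (Auto.hasLabel_labelledTree.2 ⟨h1, ?_⟩) ?_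
      · simp [h2, Auto.run, hv]
      · rintro ⟨w, j, hw, hX⟩
        obtain ⟨rfl, -⟩ := Auto.leaf.inj (hx.symm.trans hw)
        exact hv hX
  | node s l r ihl ihr =>
    obtain ⟨y, hy, hyl⟩ := Auto.Node.exists_child hx true
    obtain ⟨z, hz, hzr⟩ := Auto.Node.exists_child hx false
    refine hS.2 x y z ⟨_, hy⟩ ⟨_, hz⟩ (Auto.hasLabel_labelledTree.2 ?_)
      (fun h => ?_) _ _ _ (ihl y hyl) (ihr z hzr) (Auto.hasLabel_labelledTree.2 ?_)
    · simp [Auto.label, hy]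
    · simpa [Auto.label, hz] using Auto.hasLabel_labelledTree.1 h
    · simp only [Auto.label]
      rw [hx]
      rfl

theorem Auto.sat_accepted {X : Set V} {t : Tuple (L.labelledTree acc).carrier [.set]}
    (ht : t .set .zero = L.leafNodes X) :
    Formula.accepted.Sat (L.labelledTree acc) t ↔ acc (L.run X) := by
  rw [Formula.sat_accepted, ht]
  constructor
  · rintro ⟨-, h⟩
    obtain ⟨x, q, hq, hx⟩ := h _ (Auto.closedUnder_run X)
    obtain ⟨h1, h2⟩ := Auto.hasLabel_labelledTree.1 hq
    obtain rfl : x = L.root := Subtype.ext h1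
    obtain rfl : L.run X = q := hx
    exact h2
  · intro h
    refine ⟨?_, fun S hS => ⟨L.root, L.run X, Auto.hasLabel_labelledTree.2 ⟨rfl, h⟩,
      Auto.mem_of_closedUnder hS L L.root rfl⟩⟩
    rintro x ⟨v, i, hx, -⟩
    exact Auto.hasLabel_labelledTree.2 ⟨v, i, hx⟩

end AutoLabel

/-! ### The transduction from trees to hypergraphs -/

theorem one_le_card_label (n : ℕ) [Nonempty (Fin n)] : 1 ≤ Nat.card (Label (Fin n)) :=
  haveI : Nonempty (Label (Fin n)) :=
    ⟨⟨True, True, fun _ => Classical.arbitrary _, fun p _ => p, fun _ => True⟩⟩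
  Nat.card_pos

/-- The transduction from trees to hypergraphs of hyper-rankwidth `k` with `n = 2 ^ k`. -/
noncomputable def acceptedTransduction (n : ℕ) [Nonempty (Fin n)] :
    Transduction treeVocab hypergraphVocab :=
  .cons (.colouring (Nat.card (Label (Fin n))) (one_le_card_label n)) <|
    .cons (.interpretation (acceptedInterpretation n)) .nil

theorem acceptedTransduction_out {n : ℕ} [Nonempty (Fin n)] {H : Hypergraph}
    (L : Auto H.carrier (Fin n)) (acc : Fin n → Prop) (hL : L.leaves.Nodup)
    (hV : ∀ v, v ∈ L.leaves) (hE : ∀ X, H.Hyperedge X ↔ acc (L.run X)) :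
    (acceptedTransduction n).Out L.tree H := by
  let A := L.labelledTree acc
  let I := acceptedInterpretation n
  have hU : ∀ x : L.Node, I.univ.Sat A (Tuple.cons (κ := .elem) x Tuple.nil) ↔
      ∃ v i, x.sub = .leaf v i := fun x =>
    Formula.sat_hasLabel.trans Auto.hasLabel_labelledTree
  have hleaf : ∀ u : I.Universe A, ∃ v i, (u.1 : L.Node).sub = .leaf v i := fun u => (hU u.1).1 u.2
  -- The isomorphism g sends a leaf node to the vertex it carries. It is injective because leaves
  -- are not repeated and surjective because every vertex occurs.
  choose g i hg using hleaf
  have hbij : g.Bijective := by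
    constructor
    · intro u w huw
      have h1 := Auto.Node.sub_eq_iff.1 (hg u)
      have h2 := Auto.Node.sub_eq_iff.1 (hg w)
      rw [huw] at h1
      exact Subtype.ext (Subtype.ext (Auto.leaf_position_unique hL h1 h2))
    · intro v
      obtain ⟨p, j, hp⟩ := Auto.mem_leaves_iff.1 (hV v)
      let x : L.Node := ⟨p, by simp [hp]⟩
      have hx : x.sub = .leaf v j := Auto.Node.sub_eq_iff.2 hp
      refine ⟨⟨x, (hU x).2 ⟨v, j, hx⟩⟩, ?_⟩
      exact (Auto.leaf.inj ((hg _).symm.trans hx)).1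
  have hne : Nonempty (I.Universe A) := by
    obtain ⟨v⟩ := H.nonempty_carrier
    obtain ⟨u, -⟩ := hbij.2 v
    exact ⟨u⟩
  refine ⟨A, ⟨fun x => Finite.equivFin (Label (Fin n)) (L.label acc x), rfl⟩,
    I.output A hne, ⟨hne, rfl⟩, Equiv.ofBijective g hbij, fun r t => ?_⟩
  have ht : t.map g = Tuple.cons (κ := .set) (g '' (t .set .zero)) Tuple.nil := by
    funext κ v
    rcases v with _ | v
    · rfl
    · exact nomatch v
  -- A set of output elements, viewed in the tree, is the set of leaf nodes of its image under g;
  -- this is the input format of `Auto.sat_accepted`.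
  have hX : Set.image Subtype.val (t .set .zero : Set (I.Universe A)) =
      L.leafNodes (g '' (t .set .zero)) := by
    ext x
    constructor
    · rintro ⟨u, hu, rfl⟩
      exact ⟨g u, i u, hg u, u, hu, rfl⟩
    · rintro ⟨v, j, hx, u, hu, rfl⟩
      refine ⟨u, hu, Subtype.ext ?_⟩
      exact Auto.leaf_position_unique hL (Auto.Node.sub_eq_iff.1 (hg u))
        (Auto.Node.sub_eq_iff.1 hx)
  change Formula.accepted.Sat A (t.map Subtype.val) ↔ H.rel () (t.map g)
  rw [ht]
  exact (Auto.sat_accepted hX).trans (hE _).symm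

theorem StrClass.BoundedHyperRankwidth.boundedMSOWidth {C : StrClass hypergraphVocab}
    (hC : C.BoundedHyperRankwidth) : C.BoundedMSOWidth := by
  obtain ⟨k, hk⟩ := hC
  have : Nonempty (Fin (2 ^ k)) := ⟨⟨0, by positivity⟩⟩
  refine ⟨acceptedTransduction (2 ^ k), fun H hH => ?_⟩
  obtain ⟨L, acc, hn, hv, hE⟩ := Str.exists_auto (hk H hH)
  exact ⟨L.tree, L.isTree_tree, acceptedTransduction_out L acc hn hv hE⟩

end MSO

/-- A class of hypergraphs has bounded MSO width if and only if it has bounded hyper-rankwidth. -/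
theorem mainTheorem7 (C : MSO.StrClass MSO.hypergraphVocab) :
    C.BoundedMSOWidth ↔ C.BoundedHyperRankwidth :=
  ⟨fun h => h.boundedHyperRankwidth, fun h => h.boundedMSOWidth⟩
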